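/- Let $(\Omega,\mathcal P)$ be a probability space and $0<A<B<1$. Let $(a_n,b_n)_{n\ge 1}$ be i.i.d. pairs of random variables with $A\le\min(a_n,b_n)$ and $a_n+b_n\le B$, and let $(p_n)_{n\ge1}$ be i.i.d. random variables with values in $[0,1]$, the sequence $(p_n)$ being independent of the sequence $(a_n,b_n)$, such that $\mathbb E(p_1^{-t})<\infty$ and $\mathbb E((1-p_1)^{-t})<\infty$ for some $t>0$ (with $0^{-t}=\infty$). For each $\omega$ let $[0,1]$ be the only Moran interval of step $0$; each Moran interval $J$ of step $n-1$ has two children of step $n$: the closed subinterval of length $a_n(\omega)|J|$ sharing the left endpoint of $J$ (left child) and the closed subinterval of length $b_n(\omega)|J|$ sharing the right endpoint of $J$ (right child). Let $\mu_\omega$ be the Borel probability measure, carried by the Moran set $C_\omega=\bigcap_n C^{(n)}_\omega$ ($C_\omega^{(n)}$ is the union of the Moran intervals of step $n$), for which the left child of any interval $J$ of step $n-1$ has mass $p_n(\omega)\mu_\omega(J)$ and the right child has mass $(1-p_n(\omega))\mu_\omega(J)$. For $0<\theta<1$ let $\overline{\dim}_{\Phi_\theta}\mu$ be the infimum (and $\underline{\dim}_{\Phi_\theta}\mu$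 the supremum) of the real $d$ for which there are $C_1,C_2>0$ such that $\frac{\mu(B(x,R))}{\mu(B(x,r))}\le C_2 (R/r)^d$ (respectively $\ge C_2(R/r)^d$) for all $0<r<R^{1/\theta}\le R\le C_1$ and all $x\in\operatorname{supp}\mu$. The quasi-Assouad and quasi-lower Assouad dimensions are $\dim_{qA}\mu=\lim_{\theta\to1^-}\overline{\dim}_{\Phi_\theta}\mu$ and $\dim_{qL}\mu=\lim_{\theta\to1^-}\underline{\dim}_{\Phi_\theta}\mu$. For $\psi\ge0$ put $Y(\psi)=\log p_1$, $Z(\psi)=\log a_1$ if $p_1\le \frac{a_1^\psi}{a_1^\psi+b_1^\psi}$ and $Y(\psi)=\log(1-p_1)$, $Z(\psi)=\log b_1$ otherwise; put $Y'(\psi)=\log p_1$, $Z'(\psi)=\log a_1$ if $p_1\ge \frac{a_1^\psi}{a_1^\psi+b_1^\psi}$ and $Y'(\psi)=\log(1-p_1)$, $Z'(\psi)=\log b_1$ otherwise. Let $G(\psi)=\mathbb E(Y(\psi))/\mathbb E(Z(\psi))$ and $G'(\psi)=\mathbb E(Y'(\psi))/\mathbb E(Z'(\psi))$. Then, for every real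 $\psi\ge 0$: (i) if $G(\psi)<\psi$, then $\dim_{qA}\mu_\omega\le\psi$ almost surely; (ii) if $G(\psi)\ge\psi$, then $\dim_{qA}\mu_\omega\ge\psi$ almost surely; (iii) if $G'(\psi)>\psi$, then $\dim_{qL}\mu_\omega\ge\psi$ almost surely; (iv) if $G'(\psi)\le\psi$, then $\dim_{qL}\mu_\omega\le\psi$ almost surely. -/

import Mathlib

open MeasureTheory ProbabilityTheory Filter Topology unitInterval

/-! ### Dimensions of measures -/

/-- `d` is an admissible exponent for the upper `Φ`-dimension of `μ`: there are `C₁, C₂ > 0` with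
`μ(B(x,R)) / μ(B(x,r)) ≤ C₂ (R/r)^d` whenever `0 < r < R^{1+Φ(R)} ≤ R ≤ C₁` and `x ∈ supp μ`. -/
def UpperPhiBound {X : Type*} [PseudoMetricSpace X] [MeasurableSpace X]
    (Φ : ℝ → ℝ) (μ : Measure X) (d : ℝ) : Prop :=
  ∃ C₁ : ℝ, 0 < C₁ ∧ ∃ C₂ : ℝ, 0 < C₂ ∧
    ∀ r R : ℝ, 0 < r → r < R ^ (1 + Φ R) → R ^ (1 + Φ R) ≤ R → R ≤ C₁ →
      ∀ x ∈ μ.support,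
        μ.real (Metric.ball x R) / μ.real (Metric.ball x r) ≤ C₂ * (R / r) ^ d

/-- `d` is an admissible exponent for the lower `Φ`-dimension of `μ`: there are `C₁, C₂ > 0` with
`μ(B(x,R)) / μ(B(x,r)) ≥ C₂ (R/r)^d` whenever `0 < r < R^{1+Φ(R)} ≤ R ≤ C₁` and `x ∈ supp μ`. -/
def LowerPhiBound {X : Type*} [PseudoMetricSpace X] [MeasurableSpace X]
    (Φ : ℝ → ℝ) (μ : Measure X) (d : ℝ) : Prop :=
  ∃ C₁ : ℝ, 0 < C₁ ∧ ∃ C₂ : ℝ, 0 < C₂ ∧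
    ∀ r R : ℝ, 0 < r → r < R ^ (1 + Φ R) → R ^ (1 + Φ R) ≤ R → R ≤ C₁ →
      ∀ x ∈ μ.support,
        C₂ * (R / r) ^ d ≤ μ.real (Metric.ball x R) / μ.real (Metric.ball x r)

/-- The upper `Φ`-dimension of a finite measure (the infimum of the empty set is `+∞`). -/
noncomputable def upperPhiDim {X : Type*} [PseudoMetricSpace X] [MeasurableSpace X]
    (Φ : ℝ → ℝ) (μ : Measure X) : EReal :=
  sInf ((fun d : ℝ => (d : EReal)) '' {d : ℝ | UpperPhiBound Φ μ d})

/-- The lower `Φ`-dimension of a finite measure. -/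
noncomputable def lowerPhiDim {X : Type*} [PseudoMetricSpace X] [MeasurableSpace X]
    (Φ : ℝ → ℝ) (μ : Measure X) : EReal :=
  sSup ((fun d : ℝ => (d : EReal)) '' {d : ℝ | LowerPhiBound Φ μ d})

/-- The constant dimension function `Φ_θ = 1/θ - 1`. -/
noncomputable def phiTheta (θ : ℝ) : ℝ → ℝ := fun _ => 1 / θ - 1

/-- The quasi-Assouad dimension: the limit of the upper `Φ_θ`-dimensions as `θ → 1⁻`. -/
noncomputable def quasiAssouadDim {X : Type*} [PseudoMetricSpace X] [MeasurableSpace X]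
    (μ : Measure X) : EReal :=
  limUnder (𝓝[<] (1 : ℝ)) (fun θ => upperPhiDim (phiTheta θ) μ)

/-- The quasi-lower Assouad dimension: the limit of the lower `Φ_θ`-dimensions as `θ → 1⁻`. -/
noncomputable def quasiLowerAssouadDim {X : Type*} [PseudoMetricSpace X] [MeasurableSpace X]
    (μ : Measure X) : EReal :=
  limUnder (𝓝[<] (1 : ℝ)) (fun θ => lowerPhiDim (phiTheta θ) μ)

/-- For `0 < s ≤ t < 1` the range of radii for `Φ_s` is contained in the one for `Φ_t`. -/
theorem phiTheta_range {s t r R : ℝ} (hs : 0 < s) (hst : s ≤ t) (ht : t < 1) (hr : 0 < r)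
    (h1 : r < R ^ (1 + phiTheta s R)) (h2 : R ^ (1 + phiTheta s R) ≤ R) :
    r < R ^ (1 + phiTheta t R) ∧ R ^ (1 + phiTheta t R) ≤ R := by
  have hR : 0 < R := hr.trans (h1.trans_le h2)
  have hs1 : s < 1 := hst.trans_lt ht
  have e1 : (1 : ℝ) < 1 / s := by rw [lt_div_iff₀ hs]; linarith
  have e2 : (1 : ℝ) < 1 / t := by rw [lt_div_iff₀ (hs.trans_le hst)]; linarith
  have e3 : 1 / t ≤ 1 / s := one_div_le_one_div_of_le hs hst
  have hR1 : R ≤ 1 := by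
    by_contra hc
    push Not at hc
    have := Real.rpow_lt_rpow_of_exponent_lt hc (show (1 : ℝ) < 1 + phiTheta s R by
      simp only [phiTheta]; linarith)
    rw [Real.rpow_one] at this
    linarith
  constructor
  · refine h1.trans_le (Real.rpow_le_rpow_of_exponent_ge hR hR1 ?_)
    simp only [phiTheta]; linarith
  · calc R ^ (1 + phiTheta t R) ≤ R ^ (1 : ℝ) :=
          Real.rpow_le_rpow_of_exponent_ge hR hR1 (by simp only [phiTheta]; linarith)
      _ = R := Real.rpow_one R

/-- The limit defining the quasi-Assouad dimension exists. -/
theorem tendsto_quasiAssouadDim {X : Type*} [PseudoMetricSpace X] [MeasurableSpace X]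
    (μ : Measure X) :
    Tendsto (fun θ => upperPhiDim (phiTheta θ) μ) (𝓝[<] (1 : ℝ)) (𝓝 (quasiAssouadDim μ)) := by
  have hmono : MonotoneOn (fun θ => upperPhiDim (phiTheta θ) μ) (Set.Ioo (0 : ℝ) 1) := by
    intro s hs t ht hst
    refine sInf_le_sInf (Set.image_mono ?_)
    rintro d ⟨C₁, h1, C₂, h2, h⟩
    refine ⟨C₁, h1, C₂, h2, fun r R hr hrR hR hC x hx => ?_⟩
    obtain ⟨k1, k2⟩ := phiTheta_range hs.1 hst ht.2 hr hrR hR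
    exact h r R hr k1 k2 hC x hx
  exact tendsto_nhds_limUnder
    ⟨_, hmono.tendsto_nhdsWithin_Ioo_left ⟨1 / 2, by norm_num⟩ (OrderTop.bddAbove _)⟩

/-- The limit defining the quasi-lower Assouad dimension exists. -/
theorem tendsto_quasiLowerAssouadDim {X : Type*} [PseudoMetricSpace X] [MeasurableSpace X]
    (μ : Measure X) :
    Tendsto (fun θ => lowerPhiDim (phiTheta θ) μ) (𝓝[<] (1 : ℝ))
      (𝓝 (quasiLowerAssouadDim μ)) := by
  have hanti : AntitoneOn (fun θ => lowerPhiDim (phiTheta θ) μ) (Set.Ioo (0 : ℝ) 1) := by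
    intro s hs t ht hst
    refine sSup_le_sSup (Set.image_mono ?_)
    rintro d ⟨C₁, h1, C₂, h2, h⟩
    refine ⟨C₁, h1, C₂, h2, fun r R hr hrR hR hC x hx => ?_⟩
    obtain ⟨k1, k2⟩ := phiTheta_range hs.1 hst ht.2 hr hrR hR
    exact h r R hr k1 k2 hC x hx
  exact tendsto_nhds_limUnder
    ⟨_, hanti.tendsto_nhdsWithin_Ioo_left ⟨1 / 2, by norm_num⟩ (OrderBot.bddBelow _)⟩

/-! ### Moran sets and Moran measures

Levels are indexed from `0`: the data `a n, b n, p n` are used in passing from step `n` to step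
`n + 1`. An infinite word `v : ℕ → Bool` codes a branch (`false`: left child, `true`: right child),
and the Moran interval of step `n` on that branch depends on the first `n` letters of `v` only. -/

/-- Length of the Moran interval of step `n` on the branch `v`. -/
noncomputable def moranLength (a b : ℕ → ℝ) (v : ℕ → Bool) : ℕ → ℝ
  | 0 => 1
  | n + 1 => (if v n then b n else a n) * moranLength a b v n

/-- Left endpoint of the Moran interval of step `n` on the branch `v`: the left child shares the
left endpoint of its parent, the right child shares the right endpoint. -/
noncomputable def moranLeft (a b : ℕ → ℝ) (v : ℕ → Bool) : ℕ → ℝ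
  | 0 => 0
  | n + 1 => moranLeft a b v n + (if v n then (1 - b n) * moranLength a b v n else 0)

/-- The Moran interval of step `n` on the branch `v`. -/
def moranInterval (a b : ℕ → ℝ) (v : ℕ → Bool) (n : ℕ) : Set ℝ :=
  Set.Icc (moranLeft a b v n) (moranLeft a b v n + moranLength a b v n)

/-- The Moran set `C = ⋂ₙ C⁽ⁿ⁾`, with `C⁽ⁿ⁾` the union of the Moran intervals of step `n`. -/
def moranSet (a b : ℕ → ℝ) : Set ℝ :=
  ⋂ n : ℕ, ⋃ v : ℕ → Bool, moranInterval a b v n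

/-- The point of the Moran set on the branch `v`, that is the limit of the nondecreasing sequence of
left endpoints of the Moran intervals along `v`. -/
noncomputable def moranPoint (a b : ℕ → ℝ) (v : ℕ → Bool) : ℝ :=
  ⨆ n : ℕ, moranLeft a b v n

/-- The Moran measure: the law of the point on a random branch which, independently at each step
`n`, goes left with probability `p n` and right with probability `1 - p n`. It is the probability
measure on the line giving the children of an interval `I` of step `n` the masses `p n * μ(I)`
(left) and `(1 - p n) * μ(I)` (right), see `moranMeasure_left`, `moranMeasure_right`. -/
noncomputable def moranMeasure (a b : ℕ → ℝ) (p : ℕ → I) : Measure ℝ :=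
  (Measure.infinitePi (fun n => bernoulliMeasure false true (p n))).map (moranPoint a b)

section MoranFacts

variable {a b : ℕ → ℝ}

theorem moranLength_pos (h : ∀ n, 0 < a n ∧ 0 < b n ∧ a n + b n < 1) (v : ℕ → Bool) (n : ℕ) :
    0 < moranLength a b v n := by
  induction n with
  | zero => simp [moranLength]
  | succ n ih =>
    rw [moranLength]
    split_ifs
    · exact mul_pos (h n).2.1 ih
    · exact mul_pos (h n).1 ih

theorem moranLeft_le_succ (h : ∀ n, 0 < a n ∧ 0 < b n ∧ a n + b n < 1) (v : ℕ → Bool) (n : ℕ) :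
    moranLeft a b v n ≤ moranLeft a b v (n + 1) := by
  have hl := moranLength_pos h v n
  obtain ⟨h1, h2, h3⟩ := h n
  rw [moranLeft]
  split_ifs
  · nlinarith
  · simp

theorem moranRight_succ_le (h : ∀ n, 0 < a n ∧ 0 < b n ∧ a n + b n < 1) (v : ℕ → Bool) (n : ℕ) :
    moranLeft a b v (n + 1) + moranLength a b v (n + 1)
      ≤ moranLeft a b v n + moranLength a b v n := by
  have hl := moranLength_pos h v n
  obtain ⟨h1, h2, h3⟩ := h n
  rw [moranLeft, moranLength]
  split_ifs
  · nlinarith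
  · nlinarith

theorem moranInterval_antitone (h : ∀ n, 0 < a n ∧ 0 < b n ∧ a n + b n < 1) (v : ℕ → Bool) :
    Antitone (moranInterval a b v) :=
  antitone_nat_of_succ_le fun n =>
    Set.Icc_subset_Icc (moranLeft_le_succ h v n) (moranRight_succ_le h v n)

theorem moranPoint_mem (h : ∀ n, 0 < a n ∧ 0 < b n ∧ a n + b n < 1) (v : ℕ → Bool) (n : ℕ) :
    moranPoint a b v ∈ moranInterval a b v n := by
  have key : ∀ m k, moranLeft a b v m ≤ moranLeft a b v k + moranLength a b v k := by
    intro m k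
    have h1 : moranLeft a b v m ≤ moranLeft a b v (max m k) :=
      monotone_nat_of_le_succ (moranLeft_le_succ h v) (le_max_left m k)
    have h2 := antitone_nat_of_succ_le (f := fun n => moranLeft a b v n + moranLength a b v n)
      (moranRight_succ_le h v) (le_max_right m k)
    have h3 := moranLength_pos h v (max m k)
    simp only at h2
    linarith
  exact ⟨le_ciSup ⟨_, Set.forall_mem_range.2 fun m => key m n⟩ n, ciSup_le fun m => key m n⟩

theorem moranLeft_congr {v w : ℕ → Bool} {n : ℕ} (hvw : ∀ i < n, v i = w i) :
    moranLeft a b v n = moranLeft a b w n ∧ moranLength a b v n = moranLength a b w n := by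
  induction n with
  | zero => simp [moranLeft, moranLength]
  | succ n ih =>
    obtain ⟨h1, h2⟩ := ih fun i hi => hvw i (by omega)
    simp [moranLeft, moranLength, h1, h2, hvw n (by omega)]

theorem moranInterval_congr {v w : ℕ → Bool} {n : ℕ} (hvw : ∀ i < n, v i = w i) :
    moranInterval a b v n = moranInterval a b w n := by
  obtain ⟨h1, h2⟩ := moranLeft_congr (a := a) (b := b) hvw
  simp [moranInterval, h1, h2]

/-- The two children of a Moran interval are disjoint. -/
theorem moranInterval_disjoint (h : ∀ n, 0 < a n ∧ 0 < b n ∧ a n + b n < 1) {v w : ℕ → Bool}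
    {n : ℕ} (hvw : ∀ i < n, v i = w i) (hv : v n = false) (hw : w n = true) :
    Disjoint (moranInterval a b v (n + 1)) (moranInterval a b w (n + 1)) := by
  obtain ⟨h1, h2⟩ := moranLeft_congr (a := a) (b := b) hvw
  have hl := moranLength_pos h w n
  obtain ⟨k1, k2, k3⟩ := h n
  rw [Set.disjoint_left]
  intro x hx hy
  simp only [moranInterval, moranLeft, moranLength, hv, hw, h1, h2, Set.mem_Icc] at hx hy
  norm_num at hx hy
  nlinarith [hx.2, hy.1]

theorem moranPoint_preimage (h : ∀ n, 0 < a n ∧ 0 < b n ∧ a n + b n < 1) (v : ℕ → Bool) (n : ℕ) :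
    moranPoint a b ⁻¹' moranInterval a b v n
      = Set.pi (Finset.range n : Set ℕ) (fun i => {v i}) := by
  ext w
  simp only [Set.mem_preimage, Set.mem_pi, Finset.coe_range, Set.mem_Iio, Set.mem_singleton_iff]
  constructor
  · intro hw
    by_contra hc
    push Not at hc
    classical
    obtain ⟨hk, hne⟩ := Nat.find_spec hc
    set k := Nat.find hc with hkdef
    have hlt : ∀ i < k, w i = v i := fun i hi => by
      have := Nat.find_min hc hi
      push Not at this
      exact this (hi.trans hk)
    have m1 := moranPoint_mem h w (k + 1)
    have m2 := moranInterval_antitone h v (show k + 1 ≤ n by omega) hw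
    cases hwk : w k <;> cases hvk : v k
    · exact hne (hwk.trans hvk.symm)
    · exact Set.disjoint_left.1 (moranInterval_disjoint h hlt hwk hvk) m1 m2
    · exact Set.disjoint_left.1
        (moranInterval_disjoint h (fun i hi => (hlt i hi).symm) hvk hwk) m2 m1
    · exact hne (hwk.trans hvk.symm)
  · intro hw
    rw [← moranInterval_congr hw]
    exact moranPoint_mem h w n

theorem measurable_moranPoint : Measurable (moranPoint a b) := by
  have hlen : ∀ n, Measurable fun v : ℕ → Bool => moranLength a b v n := by
    intro n
    induction n with
    | zero => simp only [moranLength]; exact measurable_const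
    | succ n ih =>
      simp only [moranLength]
      exact (Measurable.comp (measurable_of_finite fun c : Bool => if c then b n else a n)
        (measurable_pi_apply n)).mul ih
  have hleft : ∀ n, Measurable fun v : ℕ → Bool => moranLeft a b v n := by
    intro n
    induction n with
    | zero => simp only [moranLeft]; exact measurable_const
    | succ n ih =>
      simp only [moranLeft]
      refine ih.add (Measurable.ite ?_ ((hlen n).const_mul _) measurable_const)
      exact measurableSet_eq_fun (measurable_pi_apply n) measurable_const
  exact Measurable.iSup hleft

instance isProbabilityMeasure_moranMeasure (p : ℕ → I) :
    IsProbabilityMeasure (moranMeasure a b p) :=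
  Measure.isProbabilityMeasure_map measurable_moranPoint.aemeasurable

theorem moranMeasure_interval (h : ∀ n, 0 < a n ∧ 0 < b n ∧ a n + b n < 1) (p : ℕ → I)
    (v : ℕ → Bool) (n : ℕ) :
    moranMeasure a b p (moranInterval a b v n)
      = ∏ i ∈ Finset.range n, ENNReal.ofReal (if v i then 1 - (p i : ℝ) else p i) := by
  have hm : MeasurableSet (moranInterval a b v n) := measurableSet_Icc
  rw [moranMeasure, Measure.map_apply measurable_moranPoint hm, moranPoint_preimage h, Measure.infinitePi_pi _ (fun i _ => measurableSet_singleton _)]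
  refine Finset.prod_congr rfl fun i _ => ?_
  cases v i
  · rw [bernoulliMeasure_apply_of_mem_of_notMem _ (measurableSet_singleton _)
      (Set.mem_singleton _) (by simp)]
    simp [ENNReal.ofReal, Real.toNNReal_of_nonneg (p i).2.1, unitInterval.toNNReal]
    rfl
  · rw [bernoulliMeasure_apply_of_notMem_of_mem _ (measurableSet_singleton _)
      (by simp) (Set.mem_singleton _)]
    have h1 : (0 : ℝ) ≤ 1 - p i := sub_nonneg.2 (p i).2.2
    simp [ENNReal.ofReal, Real.toNNReal_of_nonneg h1, unitInterval.toNNReal]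
    rfl

/-- The left child of an interval of step `n` gets the proportion `p n` of its mass. -/
theorem moranMeasure_left (h : ∀ n, 0 < a n ∧ 0 < b n ∧ a n + b n < 1) (p : ℕ → I)
    (v : ℕ → Bool) (n : ℕ) (hv : v n = false) :
    moranMeasure a b p (moranInterval a b v (n + 1))
      = ENNReal.ofReal (p n) * moranMeasure a b p (moranInterval a b v n) := by
  rw [moranMeasure_interval h, moranMeasure_interval h, Finset.prod_range_succ, hv, mul_comm]
  simp

/-- The right child of an interval of step `n` gets the proportion `1 - p n` of its mass. -/
theorem moranMeasure_right (h : ∀ n, 0 < a n ∧ 0 < b n ∧ a n + b n < 1) (p : ℕ → I)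
    (v : ℕ → Bool) (n : ℕ) (hv : v n = true) :
    moranMeasure a b p (moranInterval a b v (n + 1))
      = ENNReal.ofReal (1 - (p n : ℝ)) * moranMeasure a b p (moranInterval a b v n) := by
  rw [moranMeasure_interval h, moranMeasure_interval h, Finset.prod_range_succ, hv, mul_comm]
  simp

/-- Every branch point lies in the Moran set, so that the Moran measure is carried by that set. -/
theorem moranPoint_mem_moranSet (h : ∀ n, 0 < a n ∧ 0 < b n ∧ a n + b n < 1) (v : ℕ → Bool) :
    moranPoint a b v ∈ moranSet a b :=
  Set.mem_iInter.2 fun n => Set.mem_iUnion.2 ⟨v, moranPoint_mem h v n⟩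

end MoranFacts

/-! ### The threshold functions -/

/-- `Y(θ)`: equals `log p` if `p ≤ a^θ / (a^θ + b^θ)` and `log (1 - p)` otherwise. -/
noncomputable def thresholdY (θ a b p : ℝ) : ℝ :=
  if p ≤ a ^ θ / (a ^ θ + b ^ θ) then Real.log p else Real.log (1 - p)

/-- `Z(θ)`: equals `log a` if `p ≤ a^θ / (a^θ + b^θ)` and `log b` otherwise. -/
noncomputable def thresholdZ (θ a b p : ℝ) : ℝ :=
  if p ≤ a ^ θ / (a ^ θ + b ^ θ) then Real.log a else Real.log b

/-- `Y'(θ)`: equals `log p` if `p ≥ a^θ / (a^θ + b^θ)` and `log (1 - p)` otherwise. -/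
noncomputable def thresholdY' (θ a b p : ℝ) : ℝ :=
  if a ^ θ / (a ^ θ + b ^ θ) ≤ p then Real.log p else Real.log (1 - p)

/-- `Z'(θ)`: equals `log a` if `p ≥ a^θ / (a^θ + b^θ)` and `log b` otherwise. -/
noncomputable def thresholdZ' (θ a b p : ℝ) : ℝ :=
  if a ^ θ / (a ^ θ + b ^ θ) ≤ p then Real.log a else Real.log b

/-- `G(θ) = 𝔼[Y(θ)] / 𝔼[Z(θ)]` for random variables `a, b, p`. -/
noncomputable def thresholdG {Ω : Type*} [MeasurableSpace Ω] (P : Measure Ω)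
    (a b : Ω → ℝ) (p : Ω → I) (θ : ℝ) : ℝ :=
  (∫ ω, thresholdY θ (a ω) (b ω) (p ω) ∂P) / (∫ ω, thresholdZ θ (a ω) (b ω) (p ω) ∂P)

/-- `G'(θ) = 𝔼[Y'(θ)] / 𝔼[Z'(θ)]` for random variables `a, b, p`. -/
noncomputable def thresholdG' {Ω : Type*} [MeasurableSpace Ω] (P : Measure Ω)
    (a b : Ω → ℝ) (p : Ω → I) (θ : ℝ) : ℝ :=
  (∫ ω, thresholdY' θ (a ω) (b ω) (p ω) ∂P) / (∫ ω, thresholdZ' θ (a ω) (b ω) (p ω) ∂P)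

/-! ### Geometry and mass of Moran intervals -/

/-! For a child with scaling ratio `l` and conditional probability `q`, consider `ψ log l - log q`.
The threshold in `Y, Z` is exactly where the two children's values agree, so `ψ Z - Y` is their
maximum and `ψ Z' - Y'` their minimum (`threshold_eq_max`, `threshold'_eq_min`). Since `E Z < 0` and
`E Z' < 0`, comparing `G(ψ)` or `G'(ψ)` with `ψ` amounts to the sign of the mean of this extremal
value `X`.

Let `S` be the partial sums of `X`. For the maximum, every branch satisfies `log (mass n / mass N) ≤
(S N - S n) + ψ log (length n / length N)`; for the minimum the inequality is reversed. Gaps between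
Moran intervals are comparable to their lengths because `a + b ≤ B < 1`, so balls may be replaced by
Moran intervals up to constants. Radii with `r < R^(1/θ)` correspond to levels with `N - n ≥ c n`,
and over such windows the strong law fixes the sign of `S N - S n` when the mean is nonzero. As `X`
depends on the level only, one null set serves all branches, points and `θ`; this gives (i) and
(iii) through `upperPhiBound` and `lowerPhiBound`.

For (ii) and (iv), follow the branch that picks the extremal child at every step and compare levels
`n` and `(K + 1) n`. The increment of `S` has the wrong sign by at most `ε n`, whereas an exponent
on the wrong side of `ψ` costs a fixed multiple of `n`. Hence the weak inequality on the mean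
suffices (`le_of_upperPhiBound`, `le_of_lowerPhiBound`). -/

/-- The scaling ratios lie in the region `A ≤ min (a, b)`, `a + b ≤ B`, with `0 < A` and `B < 1`. -/
structure MoranBounds (A B : ℝ) (a b : ℕ → ℝ) : Prop where
  pos : 0 < A
  lt_one : B < 1
  le_left : ∀ n, A ≤ a n
  le_right : ∀ n, A ≤ b n
  add_le : ∀ n, a n + b n ≤ B

/-- The scaling ratio of the `n`-th step of the branch `v`. -/
def moranRatio (a b : ℕ → ℝ) (v : ℕ → Bool) (n : ℕ) : ℝ := if v n then b n else a n

/-- The conditional probability of the `n`-th step of the branch `v`. -/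
def moranWeight (p : ℕ → I) (v : ℕ → Bool) (n : ℕ) : ℝ := if v n then 1 - (p n : ℝ) else p n

/-- The mass of the Moran interval of step `n` on the branch `v`. -/
noncomputable def moranMass (p : ℕ → I) (v : ℕ → Bool) (n : ℕ) : ℝ :=
  ∏ i ∈ Finset.range n, moranWeight p v i

theorem moranWeight_pos {p : ℕ → I} (hp : ∀ n, 0 < (p n : ℝ) ∧ (p n : ℝ) < 1) (v : ℕ → Bool)
    (n : ℕ) : 0 < moranWeight p v n := by
  have := hp n
  unfold moranWeight
  split_ifs <;> linarith

theorem moranMass_pos {p : ℕ → I} (hp : ∀ n, 0 < (p n : ℝ) ∧ (p n : ℝ) < 1) (v : ℕ → Bool)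
    (n : ℕ) : 0 < moranMass p v n :=
  Finset.prod_pos fun i _ => moranWeight_pos hp v i

theorem log_moranMass {p : ℕ → I} (hp : ∀ n, 0 < (p n : ℝ) ∧ (p n : ℝ) < 1) (v : ℕ → Bool)
    (n : ℕ) :
    Real.log (moranMass p v n) = ∑ i ∈ Finset.range n, Real.log (moranWeight p v i) :=
  Real.log_prod fun i _ => (moranWeight_pos hp v i).ne'

namespace MoranBounds

variable {A B : ℝ} {a b : ℕ → ℝ} (h : MoranBounds A B a b)
include h

theorem B_pos : 0 < B := by
  linarith [h.pos, h.le_left 0, h.le_right 0, h.add_le 0]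

theorem A_lt_one : A < 1 := by
  linarith [h.pos, h.le_left 0, h.le_right 0, h.add_le 0, h.lt_one]

theorem ratios (n : ℕ) : 0 < a n ∧ 0 < b n ∧ a n + b n < 1 :=
  ⟨h.pos.trans_le (h.le_left n), h.pos.trans_le (h.le_right n), (h.add_le n).trans_lt h.lt_one⟩

theorem le_ratio (v : ℕ → Bool) (n : ℕ) : A ≤ moranRatio a b v n := by
  unfold moranRatio
  split_ifs
  exacts [h.le_right n, h.le_left n]

theorem ratio_le (v : ℕ → Bool) (n : ℕ) : moranRatio a b v n ≤ B := by
  have := h.ratios n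
  have := h.add_le n
  unfold moranRatio
  split_ifs <;> linarith

theorem length_pos (v : ℕ → Bool) (n : ℕ) : 0 < moranLength a b v n :=
  moranLength_pos h.ratios v n

theorem log_length (v : ℕ → Bool) (n : ℕ) :
    Real.log (moranLength a b v n)
      = ∑ i ∈ Finset.range n, Real.log (moranRatio a b v i) := by
  induction n with
  | zero => simp [moranLength]
  | succ n ih =>
    have hr : moranRatio a b v n ≠ 0 := (h.pos.trans_le (h.le_ratio v n)).ne'
    rw [Finset.sum_range_succ, ← ih, add_comm (Real.log _),
      ← Real.log_mul hr (h.length_pos v n).ne']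
    rfl

theorem length_add_le (v : ℕ → Bool) (n k : ℕ) :
    moranLength a b v (n + k) ≤ B ^ k * moranLength a b v n := by
  induction k with
  | zero => simp
  | succ k ih =>
    calc moranLength a b v (n + k + 1)
        = moranRatio a b v (n + k) * moranLength a b v (n + k) := rfl
      _ ≤ B * (B ^ k * moranLength a b v n) :=
        mul_le_mul (h.ratio_le v _) ih (h.length_pos v _).le h.B_pos.le
      _ = B ^ (k + 1) * moranLength a b v n := by ring

theorem le_length_add (v : ℕ → Bool) (n k : ℕ) :
    A ^ k * moranLength a b v n ≤ moranLength a b v (n + k) := by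
  induction k with
  | zero => simp
  | succ k ih =>
    calc A ^ (k + 1) * moranLength a b v n = A * (A ^ k * moranLength a b v n) := by ring
      _ ≤ moranRatio a b v (n + k) * moranLength a b v (n + k) :=
        mul_le_mul (h.le_ratio v _) ih
          (mul_nonneg (pow_nonneg h.pos.le _) (h.length_pos v _).le)
          (h.pos.le.trans (h.le_ratio v _))
      _ = moranLength a b v (n + k + 1) := rfl

theorem length_le (v : ℕ → Bool) (n : ℕ) : moranLength a b v n ≤ B ^ n := by
  simpa [moranLength] using h.length_add_le v 0 n

theorem length_antitone (v : ℕ → Bool) : Antitone (moranLength a b v) :=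
  antitone_nat_of_succ_le fun n => by
    have := h.length_add_le v n 1
    have := h.length_pos v n
    have := h.lt_one
    nlinarith

/-- Branches that separate at step `k` lead to points at distance at least `(1 - B) |J|`, where `J`
is their last common Moran interval. -/
theorem gap_le_dist {v w : ℕ → Bool} {k : ℕ} (hvw : ∀ i < k, v i = w i) (hk : v k ≠ w k) :
    (1 - B) * moranLength a b v k ≤ dist (moranPoint a b v) (moranPoint a b w) := by
  have key : ∀ v w : ℕ → Bool, (∀ i < k, v i = w i) → v k = false → w k = true →
      (1 - B) * moranLength a b v k ≤ moranPoint a b w - moranPoint a b v := by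
    intro v w hvw hv hw
    obtain ⟨h1, h2⟩ := moranLeft_congr (a := a) (b := b) hvw
    have m1 := (moranPoint_mem h.ratios v (k + 1)).2
    have m2 := (moranPoint_mem h.ratios w (k + 1)).1
    simp only [moranLeft, moranLength, hv, hw, if_true, ← h1, ← h2] at m1 m2
    have hl := h.length_pos v k
    have hB := h.add_le k
    norm_num at m1
    nlinarith
  rw [Real.dist_eq]
  cases hv : v k <;> cases hw : w k
  · exact absurd (hv.trans hw.symm) hk
  · exact (key v w hvw hv hw).trans (by rw [abs_sub_comm]; exact le_abs_self _)
  · rw [(moranLeft_congr (a := a) (b := b) hvw).2]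
    exact (key w v (fun i hi => (hvw i hi).symm) hw hv).trans (le_abs_self _)
  · exact absurd (hv.trans hw.symm) hk

theorem measure_interval (p : ℕ → I) (v : ℕ → Bool) (n : ℕ) :
    (moranMeasure a b p).real (moranInterval a b v n) = moranMass p v n := by
  rw [Measure.real, moranMeasure_interval h.ratios, ENNReal.toReal_prod]
  refine Finset.prod_congr rfl fun i _ => ?_
  rw [ENNReal.toReal_ofReal]
  · rfl
  · split_ifs
    exacts [sub_nonneg.2 (p i).2.2, (p i).2.1]

/-- A ball around a branch point contains the Moran intervals of the branch that are shorter than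
its radius. -/
theorem mass_le_ball (p : ℕ → I) {v : ℕ → Bool} {n : ℕ} {r : ℝ}
    (hr : moranLength a b v n < r) :
    moranMass p v n ≤ (moranMeasure a b p).real (Metric.ball (moranPoint a b v) r) := by
  rw [← h.measure_interval p v n]
  refine measureReal_mono (fun x hx => ?_) (measure_ne_top _ _)
  have hm := moranPoint_mem h.ratios v n
  have : dist x (moranPoint a b v) ≤
      moranLeft a b v n + moranLength a b v n - moranLeft a b v n :=
    Real.dist_le_of_mem_Icc hx hm
  rw [Metric.mem_ball]
  linarith

/-- A ball around a branch point whose radius is at most the gaps of the first `n` Moran intervals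
of the branch meets the Moran set only inside the Moran interval of step `n`. -/
theorem ball_le_mass (p : ℕ → I) {v : ℕ → Bool} {n : ℕ} {r : ℝ}
    (hr : ∀ k < n, r ≤ (1 - B) * moranLength a b v k) :
    (moranMeasure a b p).real (Metric.ball (moranPoint a b v) r) ≤ moranMass p v n := by
  rw [← h.measure_interval p v n, moranMeasure,
    map_measureReal_apply measurable_moranPoint Metric.isOpen_ball.measurableSet,
    map_measureReal_apply measurable_moranPoint
      (show MeasurableSet (moranInterval a b v n) from measurableSet_Icc)]
  refine measureReal_mono (fun w hw => ?_) (measure_ne_top _ _)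
  rw [moranPoint_preimage h.ratios]
  intro i hi
  simp only [Finset.coe_range, Set.mem_Iio] at hi
  rw [Set.mem_singleton_iff]
  induction i using Nat.strong_induction_on with
  | _ i ih =>
    -- At a first disagreement `i` the gap estimate pushes the point of `w` out of the ball.
    by_contra hc
    have := h.gap_le_dist (v := v) (w := w) (k := i)
      (fun j hj => (ih j hj (hj.trans hi)).symm) (Ne.symm hc)
    rw [Set.mem_preimage, Metric.mem_ball, dist_comm] at hw
    linarith [hr i hi]

/-- Every ball around the point contains a Moran interval of its branch, whose mass is a product of
positive weights. -/
theorem moranPoint_mem_support {p : ℕ → I} (hp : ∀ n, 0 < (p n : ℝ) ∧ (p n : ℝ) < 1)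
    (v : ℕ → Bool) : moranPoint a b v ∈ (moranMeasure a b p).support := by
  rw [Metric.nhds_basis_ball.mem_measureSupport]
  intro r hr
  obtain ⟨n, hn⟩ := exists_pow_lt_of_lt_one hr h.lt_one
  have h1 := h.mass_le_ball p ((h.length_le v n).trans_lt hn)
  exact (ENNReal.toReal_pos_iff.1 ((moranMass_pos hp v n).trans_le h1)).1

-- Approximating a support point by branch points, at a cost of half a radius, avoids having to show
-- that the support consists of branch points.
omit h in
theorem exists_moranPoint_near {p : ℕ → I} {x ε : ℝ} (hx : x ∈ (moranMeasure a b p).support)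
    (hε : 0 < ε) : ∃ v, dist (moranPoint a b v) x < ε := by
  rw [Metric.nhds_basis_ball.mem_measureSupport] at hx
  have h1 := hx ε hε
  rw [moranMeasure, Measure.map_apply measurable_moranPoint
    Metric.isOpen_ball.measurableSet] at h1
  obtain ⟨v, hv⟩ := nonempty_of_measure_ne_zero h1.ne'
  exact ⟨v, hv⟩

/-- The first Moran interval of a branch that is shorter than a given number. -/
theorem exists_level (v : ℕ → Bool) {R : ℝ} (hR : 0 < R) (hR1 : R ≤ 1) :
    ∃ n, moranLength a b v n < R ∧ A * R ≤ moranLength a b v n ∧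
      ∀ k < n, R ≤ moranLength a b v k := by
  classical
  have hex : ∃ n, moranLength a b v n < R := by
    obtain ⟨n, hn⟩ := exists_pow_lt_of_lt_one hR h.lt_one
    exact ⟨n, (h.length_le v n).trans_lt hn⟩
  have hmin : ∀ k < Nat.find hex, R ≤ moranLength a b v k :=
    fun k hk => not_lt.1 (Nat.find_min hex hk)
  refine ⟨Nat.find hex, Nat.find_spec hex, ?_, hmin⟩
  rcases hn : Nat.find hex with _ | m
  -- Level `0` cannot be the first: its length is `1 ≥ R`.
  · have := Nat.find_spec hex
    rw [hn, moranLength] at this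
    linarith
  · have h1 := h.le_length_add v m 1
    have h2 := hmin m (by omega)
    rw [pow_one] at h1
    exact (mul_le_mul_of_nonneg_left h2 h.pos.le).trans h1

end MoranBounds

/-! ### Averages -/

theorem eventually_abs_sub_le_of_tendsto_div {S : ℕ → ℝ} {m δ : ℝ}
    (hS : Tendsto (fun n : ℕ => S n / n) atTop (𝓝 m)) (hδ : 0 < δ) :
    ∃ n₀, ∀ n ≥ n₀, |S n - n * m| ≤ δ * n := by
  obtain ⟨n₀, hn₀⟩ := Metric.tendsto_atTop.1 hS δ hδ
  -- Index `0` is excluded: `S 0 / 0 = 0` says nothing about `S 0`.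
  refine ⟨max n₀ 1, fun n hn => ?_⟩
  have h1 := hn₀ n (le_of_max_le_left hn)
  have h2 : (0 : ℝ) < n := by exact_mod_cast (le_of_max_le_right hn : 1 ≤ n)
  have h3 : S n - n * m = (S n / n - m) * n := by field_simp
  rw [h3, abs_mul, abs_of_pos h2]
  exact mul_le_mul_of_nonneg_right h1.le h2.le

/-- If the averages `S n / n` have a negative limit, then the increments of `S` over the intervals
`[n, N]` with `N - n ≥ c n` are eventually nonpositive. -/
theorem increment_nonpos_of_tendsto_div {S : ℕ → ℝ} {m c : ℝ}
    (hS : Tendsto (fun n : ℕ => S n / n) atTop (𝓝 m)) (hm : m < 0) (hc : 0 < c) :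
    ∃ n₀, ∀ n N : ℕ, n₀ ≤ n → n ≤ N → c * n ≤ (N : ℝ) - n → S N - S n ≤ 0 := by
  -- This `δ` makes the errors at `n` and `N`, at most `δ (N + n) ≤ 2 δ N`, no larger than the drift
  -- `-m (N - n)`, because `c N ≤ (1 + c) (N - n)`.
  have hδ : 0 < -m * c / (2 * (1 + c)) := by
    have : 0 < -m := by linarith
    positivity
  obtain ⟨n₀, hn₀⟩ := eventually_abs_sub_le_of_tendsto_div hS hδ
  refine ⟨n₀, fun n N hn hN hcn => ?_⟩
  have h1 := (abs_le.1 (hn₀ n hn)).1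
  have h2 := (abs_le.1 (hn₀ N (hn.trans hN))).2
  set δ := -m * c / (2 * (1 + c)) with hδ_def
  have hδ1 : δ * (2 * (1 + c)) = -m * c := by rw [hδ_def]; field_simp
  have hnN : (n : ℝ) ≤ N := by exact_mod_cast hN
  have h3 : c * N ≤ (1 + c) * (N - n) := by linarith
  have h4 : δ * (N + n) * c ≤ -m * c * (N - n) := by
    calc δ * (N + n) * c ≤ δ * (2 * N) * c := by gcongr; linarith
      _ = 2 * δ * (c * N) := by ring
      _ ≤ 2 * δ * ((1 + c) * (N - n)) := by gcongr
      _ = (δ * (2 * (1 + c))) * (N - n) := by ring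
      _ = -m * c * (N - n) := by rw [hδ1]
  have h5 : δ * (N + n) ≤ -m * (N - n) := by
    refine le_of_mul_le_mul_right ?_ hc
    linarith
  linarith

/-- If the averages `S n / n` have a nonnegative limit, then the increments of `S` over the
intervals `[n, (K + 1) n]` are eventually at least `-ε n`. -/
theorem le_increment_of_tendsto_div {S : ℕ → ℝ} {m ε : ℝ}
    (hS : Tendsto (fun n : ℕ => S n / n) atTop (𝓝 m)) (hm : 0 ≤ m) (hε : 0 < ε) (K : ℕ) :
    ∀ᶠ n : ℕ in atTop, -(ε * n) ≤ S (n + K * n) - S n := by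
  -- The errors at `n` and `(K + 1) n` add up to `δ (K + 2) n`.
  have hδ : 0 < ε / (K + 2) := by positivity
  obtain ⟨n₀, hn₀⟩ := eventually_abs_sub_le_of_tendsto_div hS hδ
  filter_upwards [eventually_ge_atTop n₀] with n hn
  have h1 := (abs_le.1 (hn₀ n hn)).2
  have h2 := (abs_le.1 (hn₀ (n + K * n) (by omega))).1
  push_cast at h2
  have h3 : ε / (K + 2) * n + ε / (K + 2) * (n + K * n) = ε * n := by field_simp; ring
  have h4 : 0 ≤ K * n * m := by positivity
  linarith

namespace MoranBounds

variable {A B : ℝ} {a b : ℕ → ℝ} (h : MoranBounds A B a b)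
include h

/-! ### Comparison of masses and lengths along a branch -/

/-- The sum of `X`, minus `ψ` times the log length, plus the log mass, changes at step `i` by `X i`
minus the child's value of `ψ log l - log q`. The sign of this change makes it monotone here and
antitone in the reverse estimate. -/
theorem log_mass_sub_le {p : ℕ → I} (hp : ∀ n, 0 < (p n : ℝ) ∧ (p n : ℝ) < 1) {X : ℕ → ℝ} {ψ : ℝ}
    {v : ℕ → Bool}
    (hX : ∀ i, ψ * Real.log (moranRatio a b v i) - Real.log (moranWeight p v i) ≤ X i)
    {n N : ℕ} (hn : n ≤ N) :
    Real.log (moranMass p v n) - Real.log (moranMass p v N)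
      ≤ (∑ i ∈ Finset.range N, X i - ∑ i ∈ Finset.range n, X i)
        + ψ * (Real.log (moranLength a b v n) - Real.log (moranLength a b v N)) := by
  have hmono : Monotone fun k => ∑ i ∈ Finset.range k, X i
      - ψ * Real.log (moranLength a b v k) + Real.log (moranMass p v k) := by
    refine monotone_nat_of_le_succ fun k => ?_
    simp only [h.log_length, log_moranMass hp, Finset.sum_range_succ]
    linarith [hX k]
  have := hmono hn
  simp only at this
  linarith

theorem le_log_mass_sub {p : ℕ → I} (hp : ∀ n, 0 < (p n : ℝ) ∧ (p n : ℝ) < 1) {X : ℕ → ℝ} {ψ : ℝ}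
    {v : ℕ → Bool}
    (hX : ∀ i, X i ≤ ψ * Real.log (moranRatio a b v i) - Real.log (moranWeight p v i))
    {n N : ℕ} (hn : n ≤ N) :
    (∑ i ∈ Finset.range N, X i - ∑ i ∈ Finset.range n, X i)
        + ψ * (Real.log (moranLength a b v n) - Real.log (moranLength a b v N))
      ≤ Real.log (moranMass p v n) - Real.log (moranMass p v N) := by
  have hanti : Antitone fun k => ∑ i ∈ Finset.range k, X i
      - ψ * Real.log (moranLength a b v k) + Real.log (moranMass p v k) := by
    refine antitone_nat_of_succ_le fun k => ?_
    simp only [h.log_length, log_moranMass hp, Finset.sum_range_succ]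
    linarith [hX k]
  have := hanti hn
  simp only at this
  linarith

theorem log_length_add_le (v : ℕ → Bool) (n k : ℕ) :
    Real.log (moranLength a b v (n + k)) ≤ Real.log (moranLength a b v n) + k * Real.log B := by
  have := Real.log_le_log (h.length_pos v _) (h.length_add_le v n k)
  rw [Real.log_mul (pow_pos h.B_pos k).ne' (h.length_pos v n).ne', Real.log_pow] at this
  linarith

theorem le_log_length_add (v : ℕ → Bool) (n k : ℕ) :
    Real.log (moranLength a b v n) + k * Real.log A ≤ Real.log (moranLength a b v (n + k)) := by
  have := Real.log_le_log (mul_pos (pow_pos h.pos k) (h.length_pos v n)) (h.le_length_add v n k)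
  rw [Real.log_mul (pow_pos h.pos k).ne' (h.length_pos v n).ne', Real.log_pow] at this
  linarith

/-! ### Scales -/

/-- Radii `r < R ^ (1 + s)` correspond to levels `n ≤ N` with `N - n ≥ c n`, and `n` is large if `R`
is small. -/
theorem exists_level_gap {s k₁ k₂ : ℝ} (hs : 0 < s) (hk₁ : 0 < k₁) (hk₂ : 0 < k₂) :
    ∃ c : ℝ, 0 < c ∧ ∀ n₀ : ℕ, ∃ C : ℝ, 0 < C ∧ ∀ (r R : ℝ) (v : ℕ → Bool) (n N : ℕ),
      0 < r → 0 < R → r < R ^ (1 + s) → R ≤ C → moranLength a b v n < k₁ * R →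
      A * (k₁ * R) ≤ moranLength a b v n → moranLength a b v N < k₂ * r →
        n₀ ≤ n ∧ n ≤ N ∧ c * n ≤ (N : ℝ) - n := by
  have hα : Real.log A < 0 := Real.log_neg h.pos h.A_lt_one
  have hβ : Real.log B < 0 := Real.log_neg h.B_pos h.lt_one
  set α := -Real.log A with hα_def
  set β := -Real.log B with hβ_def
  have hα0 : 0 < α := by linarith
  have hβ0 : 0 < β := by linarith
  set E := α - Real.log k₁ + Real.log k₂ with hE
  -- Up to constants, `(N - n) α ≥ log (length n / length N) ≥ -s log R ≥ s β n`. Half of `s β n` is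
  -- given up to absorb the constants once `n ≥ n₁`.
  refine ⟨s * β / (2 * α), by positivity, fun n₀ => ?_⟩
  obtain ⟨n₁, hn₁⟩ := exists_nat_ge (2 * (E + s * (α - Real.log k₁)) / (s * β))
  -- With `R ≤ exp (-T)`, the first entry forces `n ≥ max n₀ n₁`, since lengths at level `n` are at
  -- least `A ^ n`; the second makes `length N < length n`, hence `n ≤ N`.
  set T := max ((max n₀ n₁ : ℕ) * α + Real.log k₁) (E / s) with hT
  refine ⟨Real.exp (-T), Real.exp_pos _, fun r R v n N hr hR hrR hRC hn1 hn2 hN => ?_⟩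
  have hlogR : Real.log R ≤ -T := by
    rw [← Real.log_exp (-T)]; exact Real.log_le_log hR hRC
  have hT1 : (max n₀ n₁ : ℕ) * α + Real.log k₁ ≤ T := le_max_left _ _
  have hT2 : E ≤ s * T := by
    have : E / s ≤ T := le_max_right _ _
    rw [div_le_iff₀ hs] at this; linarith
  have hlr : Real.log r < (1 + s) * Real.log R := by
    rw [← Real.log_rpow hR]; exact Real.log_lt_log hr hrR
  have h1 : Real.log (moranLength a b v n) < Real.log k₁ + Real.log R := by
    rw [← Real.log_mul hk₁.ne' hR.ne']; exact Real.log_lt_log (h.length_pos v n) hn1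
  have h2 : Real.log A + (Real.log k₁ + Real.log R) ≤ Real.log (moranLength a b v n) := by
    rw [← Real.log_mul hk₁.ne' hR.ne', ← Real.log_mul h.pos.ne' (by positivity)]
    exact Real.log_le_log (mul_pos h.pos (by positivity)) hn2
  have h3 : Real.log (moranLength a b v N) < Real.log k₂ + Real.log r := by
    rw [← Real.log_mul hk₂.ne' hr.ne']; exact Real.log_lt_log (h.length_pos v N) hN
  have h4 := h.le_log_length_add v 0 n
  have h5 := h.log_length_add_le v 0 n
  simp only [moranLength, Real.log_one, zero_add] at h4 h5
  have hn : max n₀ n₁ ≤ n := by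
    by_contra hc
    push Not at hc
    have : (n : ℝ) * α < (max n₀ n₁ : ℕ) * α :=
      mul_lt_mul_of_pos_right (by exact_mod_cast hc) hα0
    have : (n : ℝ) * α = -(n * Real.log A) := by rw [hα_def]; ring
    linarith
  have hsT : s * T ≤ -(s * Real.log R) := by nlinarith
  have hnN : n ≤ N := by
    by_contra hc
    push Not at hc
    have := Real.log_le_log (h.length_pos v n) (h.length_antitone v hc.le)
    linarith
  refine ⟨(le_max_left _ _).trans hn, hnN, ?_⟩
  obtain ⟨k, rfl⟩ := Nat.exists_eq_add_of_le hnN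
  have h6 := h.le_log_length_add v n k
  have h7 : (n₁ : ℝ) ≤ n := by exact_mod_cast (le_max_right _ _).trans hn
  have h8 : 2 * (E + s * (α - Real.log k₁)) ≤ s * β * n := by
    have := hn₁.trans h7
    rw [div_le_iff₀ (by positivity)] at this
    linarith
  have h9 : s * (Real.log A + (Real.log k₁ + Real.log R)) ≤ s * (n * Real.log B) :=
    mul_le_mul_of_nonneg_left (h2.trans h5) hs.le
  have h10 : s * (n * Real.log B) = -(s * β * n) := by rw [hβ_def]; ring
  have h11 : (k : ℝ) * Real.log A = -(k * α) := by rw [hα_def]; ring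
  have h12 : s * (Real.log A + (Real.log k₁ + Real.log R))
      = -(s * (α - Real.log k₁)) + s * Real.log R := by rw [hα_def]; ring
  push_cast
  rw [add_sub_cancel_left, div_mul_eq_mul_div, div_le_iff₀ (by positivity)]
  linarith

/-- If `K` is large enough, then the lengths of step `n` and `(K + 1) n` on a branch are admissible
radii for the `Φ`-dimensions, up to constants. -/
theorem exists_multiple {s : ℝ} (hs : 0 < s) (v : ℕ → Bool) :
    ∃ K : ℕ, 0 < K ∧ ∀ k₁ k₂ : ℝ, 0 < k₁ → 0 < k₂ → ∀ᶠ n : ℕ in atTop,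
      k₂ * moranLength a b v (n + K * n) < (k₁ * moranLength a b v n) ^ (1 + s) := by
  have hβ : Real.log B < 0 := Real.log_neg h.B_pos h.lt_one
  -- Then `K n log B ≤ s n log A - n ≤ s log (length n) - n`; the spare `-n` eventually beats the
  -- constants from `k₁` and `k₂`.
  obtain ⟨K, hK⟩ := exists_nat_ge ((1 - s * Real.log A) / -Real.log B)
  have hα : Real.log A < 0 := Real.log_neg h.pos h.A_lt_one
  rw [div_le_iff₀ (by linarith)] at hK
  refine ⟨K, Nat.pos_of_ne_zero ?_, fun k₁ k₂ hk₁ hk₂ => ?_⟩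
  · rintro rfl
    norm_num at hK
    nlinarith
  · filter_upwards [tendsto_natCast_atTop_atTop.eventually_gt_atTop
      (Real.log k₂ - (1 + s) * Real.log k₁)] with n hn
    have hL := h.length_pos v n
    rw [← Real.log_lt_log_iff (mul_pos hk₂ (h.length_pos v _)) (by positivity),
      Real.log_rpow (by positivity), Real.log_mul hk₁.ne' hL.ne',
      Real.log_mul hk₂.ne' (h.length_pos v _).ne']
    have h1 := h.log_length_add_le v n (K * n)
    have h2 := h.le_log_length_add v 0 n
    simp only [moranLength, Real.log_one, zero_add] at h2
    have h3 : s * (n * Real.log A) ≤ s * Real.log (moranLength a b v n) :=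
      mul_le_mul_of_nonneg_left h2 hs.le
    have h4 := mul_le_mul_of_nonneg_right hK (Nat.cast_nonneg (α := ℝ) n)
    push_cast at h1
    linarith

theorem eventually_mul_length_le (v : ℕ → Bool) (k : ℝ) {C : ℝ} (hC : 0 < C) :
    ∀ᶠ n : ℕ in atTop, k * moranLength a b v n ≤ C := by
  have h1 : Tendsto (moranLength a b v) atTop (𝓝 0) :=
    squeeze_zero (fun n => (h.length_pos v n).le) (h.length_le v)
      (tendsto_pow_atTop_nhds_zero_of_lt_one h.B_pos.le h.lt_one)
  have h2 := h1.const_mul k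
  rw [mul_zero] at h2
  exact (h2.eventually_lt_const hC).mono fun n hn => hn.le

end MoranBounds

namespace MoranBounds

variable {A B : ℝ} {a b : ℕ → ℝ} (h : MoranBounds A B a b)
include h

/-! ### `Φ`-dimensions of a Moran measure with averaging weights -/

/-- If `log (l ^ ψ / q) ≤ X` for both children at each step, where `l` is the scaling ratio and `q`
the conditional probability, and the averages of `X` have a negative limit, then `ψ` is an
admissible exponent for the upper `Φ_θ`-dimension. -/
theorem upperPhiBound {p : ℕ → I} (hp : ∀ n, 0 < (p n : ℝ) ∧ (p n : ℝ) < 1) {X : ℕ → ℝ}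
    {ψ m θ : ℝ} (hψ : 0 ≤ ψ) (hθ : 0 < θ) (hθ1 : θ < 1)
    (hX : ∀ v i, ψ * Real.log (moranRatio a b v i) - Real.log (moranWeight p v i) ≤ X i)
    (hS : Tendsto (fun n : ℕ => (∑ i ∈ Finset.range n, X i) / n) atTop (𝓝 m)) (hm : m < 0) :
    UpperPhiBound (phiTheta θ) (moranMeasure a b p) ψ := by
  have hs : 0 < 1 / θ - 1 := by
    rw [sub_pos, lt_div_iff₀ hθ]; linarith
  have hB : 0 < 1 - B := sub_pos.2 h.lt_one
  have hA := h.pos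
  -- A ball of radius `R` at `x` lies in one of radius `2R` at a nearby branch point. Stopping at
  -- length `k₁ R` makes all earlier gaps `(1 - B) * length` at least `2R`, so that ball sees only
  -- the interval of step `n`.
  set k₁ := 2 / (1 - B) with hk₁
  have hk₁0 : 0 < k₁ := by positivity
  obtain ⟨c, hc, hgap⟩ := h.exists_level_gap hs hk₁0 (show (0 : ℝ) < 1 / 2 by norm_num)
  obtain ⟨n₀, hn₀⟩ := increment_nonpos_of_tendsto_div hS hm hc
  obtain ⟨C, hC, hlev⟩ := hgap n₀
  -- The entries `1` and `1 / k₁` keep both stopping scales below the length `1` of step `0`. The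
  -- constant comes from `length n < k₁ R` and `length N ≥ A r / 2`.
  refine ⟨min C (min 1 (1 / k₁)), by positivity, (k₁ / (A / 2)) ^ ψ, by positivity,
    fun r R hr hrR hRR hRC x hx => ?_⟩
  have hR : 0 < R := hr.trans (hrR.trans_le hRR)
  have hRC1 : R ≤ C := hRC.trans (min_le_left _ _)
  have hR1 : R ≤ 1 := hRC.trans ((min_le_right _ _).trans (min_le_left _ _))
  have hRk : k₁ * R ≤ 1 := by
    have := hRC.trans ((min_le_right _ _).trans (min_le_right _ _))
    rwa [le_div_iff₀ hk₁0, mul_comm] at this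
  have hrR' : r < R := hrR.trans_le hRR
  obtain ⟨v, hv⟩ := exists_moranPoint_near hx (show 0 < 1 / 2 * r by positivity)
  obtain ⟨n, hn1, hn2, hn3⟩ := h.exists_level v (show 0 < k₁ * R by positivity) hRk
  obtain ⟨N, hN1, hN2, -⟩ := h.exists_level v (show 0 < 1 / 2 * r by positivity) (by linarith)
  obtain ⟨hn, hnN, hcn⟩ := hlev r R v n N hr hR hrR hRC1 hn1 hn2 hN1
  have hup : (moranMeasure a b p).real (Metric.ball x R) ≤ moranMass p v n := by
    refine (measureReal_mono (Metric.ball_subset_ball' ?_) (measure_ne_top _ _)).trans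
      (h.ball_le_mass p (v := v) (r := 2 * R) fun k hk => ?_)
    · rw [dist_comm]; linarith
    · have := hn3 k hk
      rw [hk₁, div_mul_eq_mul_div, div_le_iff₀ hB] at this
      linarith
  have hlow : moranMass p v N ≤ (moranMeasure a b p).real (Metric.ball x r) :=
    (h.mass_le_ball p hN1).trans
      (measureReal_mono (Metric.ball_subset_ball' (by linarith)) (measure_ne_top _ _))
  have hMn := moranMass_pos hp v n
  have hMN := moranMass_pos hp v N
  have hLn := h.length_pos v n
  have hLN := h.length_pos v N
  have hlog := h.log_mass_sub_le hp (hX v) hnN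
  have hinc := hn₀ n N hn hnN hcn
  rw [← Real.log_div hMn.ne' hMN.ne', ← Real.log_div hLn.ne' hLN.ne'] at hlog
  have hmass : moranMass p v n / moranMass p v N
      ≤ (moranLength a b v n / moranLength a b v N) ^ ψ := by
    rw [← Real.log_le_log_iff (by positivity) (by positivity), Real.log_rpow (by positivity)]
    linarith
  calc (moranMeasure a b p).real (Metric.ball x R) / (moranMeasure a b p).real (Metric.ball x r)
      ≤ moranMass p v n / moranMass p v N := div_le_div₀ hMn.le hup hMN hlow
    _ ≤ (moranLength a b v n / moranLength a b v N) ^ ψ := hmass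
    _ ≤ (k₁ * R / (A * (1 / 2 * r))) ^ ψ :=
        Real.rpow_le_rpow (by positivity)
          (div_le_div₀ (by positivity) hn1.le (by positivity) hN2) hψ
    _ = (k₁ / (A / 2)) ^ ψ * (R / r) ^ ψ := by
        rw [← Real.mul_rpow (by positivity) (by positivity)]
        congr 1
        field_simp

/-- If `X ≤ log (l ^ ψ / q)` for both children at each step, where `l` is the scaling ratio and `q`
the conditional probability, and the averages of `X` have a positive limit, then `ψ` is an
admissible exponent for the lower `Φ_θ`-dimension. -/
theorem lowerPhiBound {p : ℕ → I} (hp : ∀ n, 0 < (p n : ℝ) ∧ (p n : ℝ) < 1) {X : ℕ → ℝ}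
    {ψ m θ : ℝ} (hψ : 0 ≤ ψ) (hθ : 0 < θ) (hθ1 : θ < 1)
    (hX : ∀ v i, X i ≤ ψ * Real.log (moranRatio a b v i) - Real.log (moranWeight p v i))
    (hS : Tendsto (fun n : ℕ => (∑ i ∈ Finset.range n, X i) / n) atTop (𝓝 m)) (hm : 0 < m) :
    LowerPhiBound (phiTheta θ) (moranMeasure a b p) ψ := by
  have hs : 0 < 1 / θ - 1 := by
    rw [sub_pos, lt_div_iff₀ hθ]; linarith
  have hB : 0 < 1 - B := sub_pos.2 h.lt_one
  have hA := h.pos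
  -- Now the small ball needs the bound from above, so the gap factor goes with `r` and the factor
  -- `1/2` with `R`.
  set k₂ := 2 / (1 - B) with hk₂
  have hk₂0 : 0 < k₂ := by positivity
  obtain ⟨c, hc, hgap⟩ := h.exists_level_gap hs (show (0 : ℝ) < 1 / 2 by norm_num) hk₂0
  have hS' : Tendsto (fun n : ℕ => (-∑ i ∈ Finset.range n, X i) / n) atTop (𝓝 (-m)) := by
    simpa only [neg_div] using hS.neg
  obtain ⟨n₀, hn₀⟩ := increment_nonpos_of_tendsto_div hS' (neg_lt_zero.2 hm) hc
  obtain ⟨C, hC, hlev⟩ := hgap n₀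
  refine ⟨min C (min 1 (1 / k₂)), by positivity, (A / 2 / k₂) ^ ψ, by positivity,
    fun r R hr hrR hRR hRC x hx => ?_⟩
  have hR : 0 < R := hr.trans (hrR.trans_le hRR)
  have hRC1 : R ≤ C := hRC.trans (min_le_left _ _)
  have hR1 : R ≤ 1 := hRC.trans ((min_le_right _ _).trans (min_le_left _ _))
  have hrR' : r < R := hrR.trans_le hRR
  have hrk : k₂ * r ≤ 1 := by
    have := hrR'.le.trans (hRC.trans ((min_le_right _ _).trans (min_le_right _ _)))
    rwa [le_div_iff₀ hk₂0, mul_comm] at this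
  obtain ⟨v, hv⟩ := exists_moranPoint_near hx (show 0 < 1 / 2 * r by positivity)
  obtain ⟨n, hn1, hn2, -⟩ := h.exists_level v (show 0 < 1 / 2 * R by positivity) (by linarith)
  obtain ⟨N, hN1, hN2, hN3⟩ := h.exists_level v (show 0 < k₂ * r by positivity) hrk
  obtain ⟨hn, hnN, hcn⟩ := hlev r R v n N hr hR hrR hRC1 hn1 hn2 hN1
  have hup : (moranMeasure a b p).real (Metric.ball x r) ≤ moranMass p v N := by
    refine (measureReal_mono (Metric.ball_subset_ball' ?_) (measure_ne_top _ _)).trans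
      (h.ball_le_mass p (v := v) (r := 2 * r) fun k hk => ?_)
    · rw [dist_comm]; linarith
    · have := hN3 k hk
      rw [hk₂, div_mul_eq_mul_div, div_le_iff₀ hB] at this
      linarith
  have hlow : moranMass p v n ≤ (moranMeasure a b p).real (Metric.ball x R) :=
    (h.mass_le_ball p hn1).trans
      (measureReal_mono (Metric.ball_subset_ball' (by linarith)) (measure_ne_top _ _))
  -- Were this mass zero, the quotient would take the default value `0` and the lower bound would
  -- fail.
  have hpos : 0 < (moranMeasure a b p).real (Metric.ball x r) := by
    obtain ⟨k, hk, -, -⟩ :=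
      h.exists_level v (show 0 < 1 / 2 * r by positivity) (by linarith)
    exact (moranMass_pos hp v k).trans_le ((h.mass_le_ball p hk).trans
      (measureReal_mono (Metric.ball_subset_ball' (by linarith)) (measure_ne_top _ _)))
  have hMn := moranMass_pos hp v n
  have hMN := moranMass_pos hp v N
  have hLn := h.length_pos v n
  have hLN := h.length_pos v N
  have hlog := h.le_log_mass_sub hp (hX v) hnN
  have hinc := hn₀ n N hn hnN hcn
  rw [← Real.log_div hMn.ne' hMN.ne', ← Real.log_div hLn.ne' hLN.ne'] at hlog
  have hmass : (moranLength a b v n / moranLength a b v N) ^ ψ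
      ≤ moranMass p v n / moranMass p v N := by
    rw [← Real.log_le_log_iff (by positivity) (by positivity), Real.log_rpow (by positivity)]
    linarith
  calc (A / 2 / k₂) ^ ψ * (R / r) ^ ψ = (A * (1 / 2 * R) / (k₂ * r)) ^ ψ := by
        rw [← Real.mul_rpow (by positivity) (by positivity)]
        congr 1
        field_simp
    _ ≤ (moranLength a b v n / moranLength a b v N) ^ ψ :=
        Real.rpow_le_rpow (by positivity) (div_le_div₀ hLn.le hn2 hLN hN1.le) hψ
    _ ≤ moranMass p v n / moranMass p v N := hmass
    _ ≤ (moranMeasure a b p).real (Metric.ball x R)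
        / (moranMeasure a b p).real (Metric.ball x r) :=
        div_le_div₀ measureReal_nonneg hlow hpos hup

/-- If `X ≤ log (l ^ ψ / q)` along some branch and the averages of `X` have a nonnegative limit,
then no exponent below `ψ` is admissible for the upper `Φ_θ`-dimension. -/
theorem le_of_upperPhiBound {p : ℕ → I} (hp : ∀ n, 0 < (p n : ℝ) ∧ (p n : ℝ) < 1) {X : ℕ → ℝ}
    {ψ m θ d : ℝ} (hθ : 0 < θ) (hθ1 : θ < 1) {v : ℕ → Bool}
    (hX : ∀ i, X i ≤ ψ * Real.log (moranRatio a b v i) - Real.log (moranWeight p v i))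
    (hS : Tendsto (fun n : ℕ => (∑ i ∈ Finset.range n, X i) / n) atTop (𝓝 m)) (hm : 0 ≤ m)
    (hd : UpperPhiBound (phiTheta θ) (moranMeasure a b p) d) : ψ ≤ d := by
  by_contra! hdψ
  have hs : 0 < 1 / θ - 1 := by
    rw [sub_pos, lt_div_iff₀ hθ]; linarith
  have hB : 0 < 1 - B := sub_pos.2 h.lt_one
  obtain ⟨C₁, hC₁, C₂, hC₂, hd⟩ := hd
  obtain ⟨K, hK0, hK⟩ := h.exists_multiple hs v
  have hβ : 0 < -Real.log B := neg_pos.2 (Real.log_neg h.B_pos h.lt_one)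
  have hK0' : (0 : ℝ) < K := by exact_mod_cast hK0
  -- The lengths of levels `n` and `(K + 1) n` contribute at least `2 ε n` to the mismatch of
  -- exponents: one `ε n` pays for the increment of `S`, the other for the constant `E`.
  set ε := (ψ - d) * K * -Real.log B / 2 with hε
  have hε0 : 0 < ε := by
    have : 0 < ψ - d := sub_pos.2 hdψ
    positivity
  -- The radii are `2 * length n`, whose ball contains the interval of step `n`, and `(1 - B) *
  -- length N`, whose ball has at most the mass of the interval of step `N`. Working with logarithms
  -- allows `d` of any sign.
  set E := Real.log C₂ + d * (Real.log 2 - Real.log (1 - B)) with hE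
  obtain ⟨n, h1, h2, h3, h4, h5⟩ := ((hK 2 (1 - B) two_pos hB).and
    ((h.eventually_mul_length_le v 2 hC₁).and ((h.eventually_mul_length_le v 2 one_pos).and
    ((le_increment_of_tendsto_div hS hm hε0 K).and
    ((tendsto_natCast_atTop_atTop.const_mul_atTop hε0).eventually_gt_atTop E))))).exists
  set N := n + K * n with hN
  have hLn := h.length_pos v n
  have hLN := h.length_pos v N
  have hMn := moranMass_pos hp v n
  have hMN := moranMass_pos hp v N
  have hr : 0 < (1 - B) * moranLength a b v N := by positivity
  have hbd := hd _ _ hr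
    (show _ < (2 * moranLength a b v n) ^ (1 + phiTheta θ (2 * moranLength a b v n)) from h1)
    (by
      have := Real.rpow_le_rpow_of_exponent_ge (show 0 < 2 * moranLength a b v n by positivity) h3
        (show 1 ≤ 1 + phiTheta θ (2 * moranLength a b v n) by simp only [phiTheta]; linarith)
      rwa [Real.rpow_one] at this)
    h2 _ (h.moranPoint_mem_support hp v)
  have hlow := h.mass_le_ball p (v := v) (n := n) (r := 2 * moranLength a b v n) (by linarith)
  have hup := h.ball_le_mass p (v := v) (n := N) (r := (1 - B) * moranLength a b v N)
    fun k hk => mul_le_mul_of_nonneg_left (h.length_antitone v hk.le) hB.le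
  have hpos : 0 < (moranMeasure a b p).real
      (Metric.ball (moranPoint a b v) ((1 - B) * moranLength a b v N)) :=
    ENNReal.toReal_pos ((Metric.nhds_basis_ball.mem_measureSupport.1
      (h.moranPoint_mem_support hp v)) _ hr).ne' (measure_ne_top _ _)
  have hquot := (div_le_div₀ measureReal_nonneg hlow hpos hup).trans hbd
  have hlog := Real.log_le_log (by positivity) hquot
  rw [Real.log_div hMn.ne' hMN.ne', Real.log_mul hC₂.ne' (by positivity),
    Real.log_rpow (by positivity), Real.log_div (by positivity) hr.ne',
    Real.log_mul two_ne_zero hLn.ne', Real.log_mul hB.ne' hLN.ne'] at hlog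
  have hcmp := h.le_log_mass_sub hp hX (show n ≤ N by omega)
  have hlen := mul_le_mul_of_nonneg_left (h.log_length_add_le v n (K * n))
    (sub_pos.2 hdψ).le
  push_cast at hlen
  have : ε * n * 2 = (ψ - d) * (K * n * -Real.log B) := by rw [hε]; ring
  linarith

/-- If `log (l ^ ψ / q) ≤ X` along some branch and the averages of `X` have a nonpositive limit,
then no exponent above `ψ` is admissible for the lower `Φ_θ`-dimension. -/
theorem le_of_lowerPhiBound {p : ℕ → I} (hp : ∀ n, 0 < (p n : ℝ) ∧ (p n : ℝ) < 1) {X : ℕ → ℝ}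
    {ψ m θ d : ℝ} (hθ : 0 < θ) (hθ1 : θ < 1) {v : ℕ → Bool}
    (hX : ∀ i, ψ * Real.log (moranRatio a b v i) - Real.log (moranWeight p v i) ≤ X i)
    (hS : Tendsto (fun n : ℕ => (∑ i ∈ Finset.range n, X i) / n) atTop (𝓝 m)) (hm : m ≤ 0)
    (hd : LowerPhiBound (phiTheta θ) (moranMeasure a b p) d) : d ≤ ψ := by
  by_contra! hdψ
  have hs : 0 < 1 / θ - 1 := by
    rw [sub_pos, lt_div_iff₀ hθ]; linarith
  have hB : 0 < 1 - B := sub_pos.2 h.lt_one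
  obtain ⟨C₁, hC₁, C₂, hC₂, hd⟩ := hd
  obtain ⟨K, hK0, hK⟩ := h.exists_multiple hs v
  have hβ : 0 < -Real.log B := neg_pos.2 (Real.log_neg h.B_pos h.lt_one)
  have hK0' : (0 : ℝ) < K := by exact_mod_cast hK0
  set ε := (d - ψ) * K * -Real.log B / 2 with hε
  have hε0 : 0 < ε := by
    have : 0 < d - ψ := sub_pos.2 hdψ
    positivity
  -- The factors are exchanged: the large radius is `(1 - B) * length n`, the small one `2 * length
  -- N`.
  set E := -Real.log C₂ - d * (Real.log (1 - B) - Real.log 2) with hE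
  have hS' : Tendsto (fun n : ℕ => (-∑ i ∈ Finset.range n, X i) / n) atTop (𝓝 (-m)) := by
    simpa only [neg_div] using hS.neg
  obtain ⟨n, h1, h2, h3, h4, h5⟩ := ((hK (1 - B) 2 hB two_pos).and
    ((h.eventually_mul_length_le v (1 - B) hC₁).and
    ((h.eventually_mul_length_le v (1 - B) one_pos).and
    ((le_increment_of_tendsto_div hS' (neg_nonneg.2 hm) hε0 K).and
    ((tendsto_natCast_atTop_atTop.const_mul_atTop hε0).eventually_gt_atTop E))))).exists
  set N := n + K * n with hN
  have hLn := h.length_pos v n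
  have hLN := h.length_pos v N
  have hMn := moranMass_pos hp v n
  have hMN := moranMass_pos hp v N
  have hr : 0 < 2 * moranLength a b v N := by positivity
  have hR : 0 < (1 - B) * moranLength a b v n := by positivity
  have hbd := hd _ _ hr
    (show _ < ((1 - B) * moranLength a b v n)
      ^ (1 + phiTheta θ ((1 - B) * moranLength a b v n)) from h1)
    (by
      have := Real.rpow_le_rpow_of_exponent_ge hR h3
        (show 1 ≤ 1 + phiTheta θ ((1 - B) * moranLength a b v n) by
          simp only [phiTheta]; linarith)
      rwa [Real.rpow_one] at this)
    h2 _ (h.moranPoint_mem_support hp v)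
  have hlow := h.mass_le_ball p (v := v) (n := N) (r := 2 * moranLength a b v N) (by linarith)
  have hup := h.ball_le_mass p (v := v) (n := n) (r := (1 - B) * moranLength a b v n)
    fun k hk => mul_le_mul_of_nonneg_left (h.length_antitone v hk.le) hB.le
  have hquot := hbd.trans (div_le_div₀ hMn.le hup hMN hlow)
  have hlog := Real.log_le_log (by positivity) hquot
  rw [Real.log_div hMn.ne' hMN.ne', Real.log_mul hC₂.ne' (by positivity),
    Real.log_rpow (by positivity), Real.log_div hR.ne' hr.ne',
    Real.log_mul two_ne_zero hLN.ne', Real.log_mul hB.ne' hLn.ne'] at hlog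
  have hcmp := h.log_mass_sub_le hp hX (show n ≤ N by omega)
  have hlen := mul_le_mul_of_nonneg_left (h.log_length_add_le v n (K * n))
    (sub_pos.2 hdψ).le
  push_cast at hlen
  have : ε * n * 2 = (d - ψ) * (K * n * -Real.log B) := by rw [hε]; ring
  linarith

end MoranBounds

/-! ### The threshold functions -/

/-- Clearing denominators gives `p * b ^ θ ≤ (1 - p) * a ^ θ`; then take logarithms. At equality the
children tie, so the convention there is harmless for the maximum and for the minimum. -/
theorem le_threshold_iff {θ a b p : ℝ} (ha : 0 < a) (hb : 0 < b) (hp : 0 < p) (hp1 : p < 1) :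
    p ≤ a ^ θ / (a ^ θ + b ^ θ)
      ↔ θ * Real.log b - Real.log (1 - p) ≤ θ * Real.log a - Real.log p := by
  have ha' : 0 < a ^ θ := Real.rpow_pos_of_pos ha θ
  have hb' : 0 < b ^ θ := Real.rpow_pos_of_pos hb θ
  have hq : 0 < 1 - p := sub_pos.2 hp1
  have h1 : p ≤ a ^ θ / (a ^ θ + b ^ θ) ↔ p * b ^ θ ≤ (1 - p) * a ^ θ := by
    rw [le_div_iff₀ (by positivity)]
    constructor <;> intro h <;> linarith
  rw [h1, ← Real.log_le_log_iff (by positivity) (by positivity), Real.log_mul hp.ne' hb'.ne',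
    Real.log_mul hq.ne' ha'.ne', Real.log_rpow ha, Real.log_rpow hb]
  constructor <;> intro h <;> linarith

theorem threshold_le_iff {θ a b p : ℝ} (ha : 0 < a) (hb : 0 < b) (hp : 0 < p) (hp1 : p < 1) :
    a ^ θ / (a ^ θ + b ^ θ) ≤ p
      ↔ θ * Real.log a - Real.log p ≤ θ * Real.log b - Real.log (1 - p) := by
  have ha' : 0 < a ^ θ := Real.rpow_pos_of_pos ha θ
  have hb' : 0 < b ^ θ := Real.rpow_pos_of_pos hb θ
  have hq : 0 < 1 - p := sub_pos.2 hp1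
  have h1 : a ^ θ / (a ^ θ + b ^ θ) ≤ p ↔ (1 - p) * a ^ θ ≤ p * b ^ θ := by
    rw [div_le_iff₀ (by positivity)]
    constructor <;> intro h <;> linarith
  rw [h1, ← Real.log_le_log_iff (by positivity) (by positivity), Real.log_mul hp.ne' hb'.ne',
    Real.log_mul hq.ne' ha'.ne', Real.log_rpow ha, Real.log_rpow hb]
  constructor <;> intro h <;> linarith

/-- `θ Z(θ) - Y(θ)` is the larger of the values of `log (l ^ θ / q)` for the two children. -/
theorem threshold_eq_max {θ a b p : ℝ} (ha : 0 < a) (hb : 0 < b) (hp : 0 < p) (hp1 : p < 1) :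
    θ * thresholdZ θ a b p - thresholdY θ a b p
      = max (θ * Real.log a - Real.log p) (θ * Real.log b - Real.log (1 - p)) := by
  unfold thresholdZ thresholdY
  split_ifs with hc
  · rw [max_eq_left ((le_threshold_iff ha hb hp hp1).1 hc)]
  · rw [le_threshold_iff ha hb hp hp1, not_le] at hc
    rw [max_eq_right hc.le]

/-- `θ Z'(θ) - Y'(θ)` is the smaller of the values of `log (l ^ θ / q)` for the two children. -/
theorem threshold'_eq_min {θ a b p : ℝ} (ha : 0 < a) (hb : 0 < b) (hp : 0 < p) (hp1 : p < 1) :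
    θ * thresholdZ' θ a b p - thresholdY' θ a b p
      = min (θ * Real.log a - Real.log p) (θ * Real.log b - Real.log (1 - p)) := by
  unfold thresholdZ' thresholdY'
  split_ifs with hc
  · rw [min_eq_left ((threshold_le_iff ha hb hp hp1).1 hc)]
  · rw [threshold_le_iff ha hb hp hp1, not_le] at hc
    rw [min_eq_right hc.le]

theorem measurableSet_le_threshold (θ : ℝ) :
    MeasurableSet {x : (ℝ × ℝ) × I | (x.2 : ℝ) ≤ x.1.1 ^ θ / (x.1.1 ^ θ + x.1.2 ^ θ)} :=
  measurableSet_le (by fun_prop) (by fun_prop)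

theorem measurableSet_threshold_le (θ : ℝ) :
    MeasurableSet {x : (ℝ × ℝ) × I | x.1.1 ^ θ / (x.1.1 ^ θ + x.1.2 ^ θ) ≤ (x.2 : ℝ)} :=
  measurableSet_le (by fun_prop) (by fun_prop)

theorem measurable_thresholdY (θ : ℝ) :
    Measurable fun x : (ℝ × ℝ) × I => thresholdY θ x.1.1 x.1.2 x.2 :=
  Measurable.ite (measurableSet_le_threshold θ) (by fun_prop) (by fun_prop)

theorem measurable_thresholdZ (θ : ℝ) :
    Measurable fun x : (ℝ × ℝ) × I => thresholdZ θ x.1.1 x.1.2 x.2 :=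
  Measurable.ite (measurableSet_le_threshold θ) (by fun_prop) (by fun_prop)

theorem measurable_thresholdY' (θ : ℝ) :
    Measurable fun x : (ℝ × ℝ) × I => thresholdY' θ x.1.1 x.1.2 x.2 :=
  Measurable.ite (measurableSet_threshold_le θ) (by fun_prop) (by fun_prop)

theorem measurable_thresholdZ' (θ : ℝ) :
    Measurable fun x : (ℝ × ℝ) × I => thresholdZ' θ x.1.1 x.1.2 x.2 :=
  Measurable.ite (measurableSet_threshold_le θ) (by fun_prop) (by fun_prop)

/-! ### Probability -/

section Probability

variable {Ω : Type*} [MeasurableSpace Ω] {P : Measure Ω}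

/-- If `X, X'` are independent, `Y, Y'` are independent and `(Y, Y')` is independent of `(X, X')`,
then `(X, Y)` and `(X', Y')` are independent. -/
theorem indepFun_prodMk_of_indepFun [IsProbabilityMeasure P] {α β : Type*} [MeasurableSpace α]
    [MeasurableSpace β]
    {X X' : Ω → α} {Y Y' : Ω → β} (hX : Measurable X) (hX' : Measurable X') (hY : Measurable Y)
    (hY' : Measurable Y') (hXX : IndepFun X X' P) (hYY : IndepFun Y Y' P)
    (hYX : IndepFun (fun ω => (Y ω, Y' ω)) (fun ω => (X ω, X' ω)) P) :
    IndepFun (fun ω => (X ω, Y ω)) (fun ω => (X' ω, Y' ω)) P := by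
  have hgen : ∀ f : Ω → α × β, MeasurableSpace.comap f inferInstance
      = MeasurableSpace.generateFrom {s | ∃ t ∈ Set.image2 (· ×ˢ ·) {s : Set α | MeasurableSet s}
        {t : Set β | MeasurableSet t}, f ⁻¹' t = s} := by
    intro f
    rw [← generateFrom_prod, MeasurableSpace.comap_generateFrom]
    rfl
  -- It is enough to test independence on the π-system of preimages of measurable rectangles.
  refine IndepSets.indep (hX.prodMk hY).comap_le (hX'.prodMk hY').comap_le
    (isPiSystem_prod.comap _) (isPiSystem_prod.comap _) (hgen _) (hgen _) ?_
  rw [IndepSets_iff]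
  rintro _ _ ⟨_, ⟨s, hs, t, ht, rfl⟩, rfl⟩ ⟨_, ⟨s', hs', t', ht', rfl⟩, rfl⟩
  have e1 : P (X ⁻¹' s ∩ X' ⁻¹' s') = P (X ⁻¹' s) * P (X' ⁻¹' s') :=
    hXX.measure_inter_preimage_eq_mul _ _ hs hs'
  have e2 : P (Y ⁻¹' t ∩ Y' ⁻¹' t') = P (Y ⁻¹' t) * P (Y' ⁻¹' t') :=
    hYY.measure_inter_preimage_eq_mul _ _ ht ht'
  have e3 : P ((Y ⁻¹' t ∩ Y' ⁻¹' t') ∩ (X ⁻¹' s ∩ X' ⁻¹' s'))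
      = P (Y ⁻¹' t ∩ Y' ⁻¹' t') * P (X ⁻¹' s ∩ X' ⁻¹' s') :=
    hYX.measure_inter_preimage_eq_mul _ _ (ht.prod ht') (hs.prod hs')
  have e4 : P (Y ⁻¹' t ∩ X ⁻¹' s) = P (Y ⁻¹' t) * P (X ⁻¹' s) :=
    (hYX.comp measurable_fst measurable_fst).measure_inter_preimage_eq_mul _ _ ht hs
  have e5 : P (Y' ⁻¹' t' ∩ X' ⁻¹' s') = P (Y' ⁻¹' t') * P (X' ⁻¹' s') :=
    (hYX.comp measurable_snd measurable_snd).measure_inter_preimage_eq_mul _ _ ht' hs'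
  have f1 : (fun ω => (X ω, Y ω)) ⁻¹' s ×ˢ t = Y ⁻¹' t ∩ X ⁻¹' s := by
    ext ω; exact and_comm
  have f2 : (fun ω => (X' ω, Y' ω)) ⁻¹' s' ×ˢ t' = Y' ⁻¹' t' ∩ X' ⁻¹' s' := by
    ext ω; exact and_comm
  simp only [f1, f2]
  rw [Set.inter_inter_inter_comm, e3, e1, e2, e4, e5]
  ring

/-- The logarithm of a variable in `[0, 1]` with a finite negative moment is integrable. -/
theorem integrable_log_of_lintegral_rpow_neg {f : Ω → ℝ} (hf : Measurable f) (h0 : ∀ ω, 0 ≤ f ω)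
    (h1 : ∀ ω, f ω ≤ 1) {t : ℝ} (ht : 0 < t)
    (hint : ∫⁻ ω, ENNReal.ofReal (f ω) ^ (-t) ∂P < ⊤) :
    Integrable (fun ω => Real.log (f ω)) P := by
  have hg := integrable_toReal_of_lintegral_ne_top
    (hf.ennreal_ofReal.pow_const (-t)).aemeasurable hint.ne
  refine (hg.div_const t).mono' hf.log.aestronglyMeasurable (ae_of_all _ fun ω => ?_)
  rw [Real.norm_eq_abs, abs_of_nonpos (Real.log_nonpos (h0 ω) (h1 ω)), ← Real.log_inv]
  -- This is `log y ≤ y ^ t / t` at `y = 1 / f`. Where `f = 0`, both sides take the default value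
  -- `0`.
  have := Real.log_le_rpow_div (inv_nonneg.2 (h0 ω)) ht
  rwa [Real.inv_rpow (h0 ω), ← Real.rpow_neg (h0 ω), ← ENNReal.toReal_ofReal (h0 ω),
    ENNReal.toReal_rpow, ENNReal.toReal_ofReal (h0 ω)] at this

/-- The integrand is `⊤` wherever `f ≤ 0`, so that set is null. -/
theorem ae_pos_of_lintegral_rpow_neg {f : Ω → ℝ} (hf : Measurable f) {t : ℝ} (ht : 0 < t)
    (hint : ∫⁻ ω, ENNReal.ofReal (f ω) ^ (-t) ∂P < ⊤) : ∀ᵐ ω ∂P, 0 < f ω := by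
  filter_upwards [ae_lt_top (hf.ennreal_ofReal.pow_const (-t)) hint.ne] with ω hω
  by_contra! hc
  rw [ENNReal.ofReal_of_nonpos hc, ENNReal.zero_rpow_of_neg (by linarith)] at hω
  exact lt_irrefl _ hω

/-- The strong law of large numbers for functions of two independent i.i.d. sequences. -/
theorem strong_law_prodMk {α β : Type*} [MeasurableSpace α] [MeasurableSpace β]
    [IsProbabilityMeasure P] {X : ℕ → Ω → α} {Y : ℕ → Ω → β} (hX : ∀ n, Measurable (X n))
    (hY : ∀ n, Measurable (Y n)) (hX_indep : iIndepFun X P) (hY_indep : iIndepFun Y P)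
    (hX_ident : ∀ n, IdentDistrib (X n) (X 0) P P) (hY_ident : ∀ n, IdentDistrib (Y n) (Y 0) P P)
    (hYX : IndepFun (fun ω n => Y n ω) (fun ω n => X n ω) P) {f : α × β → ℝ} (hf : Measurable f)
    (hint : Integrable (fun ω => f (X 0 ω, Y 0 ω)) P) :
    ∀ᵐ ω ∂P, Tendsto (fun n : ℕ => (∑ i ∈ Finset.range n, f (X i ω, Y i ω)) / n) atTop
      (𝓝 (∫ ω, f (X 0 ω, Y 0 ω) ∂P)) := by
  -- Equality of the marginal laws gives equality of the laws of the pairs only thanks to this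
  -- independence.
  have hcoord : ∀ n, IndepFun (X n) (Y n) P := fun n =>
    (hYX.comp (measurable_pi_apply n) (measurable_pi_apply n)).symm
  refine strong_law_ae_real (fun n ω => f (X n ω, Y n ω)) hint (fun i j hij => ?_) fun n => ?_
  · refine (indepFun_prodMk_of_indepFun (hX i) (hX j) (hY i) (hY j) (hX_indep.indepFun hij)
      (hY_indep.indepFun hij) ?_).comp hf hf
    exact hYX.comp ((measurable_pi_apply i).prodMk (measurable_pi_apply j))
      ((measurable_pi_apply i).prodMk (measurable_pi_apply j))
  · exact ((hX_ident n).prodMk (hY_ident n) (hcoord n) (hcoord 0)).comp hf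

end Probability

/-! ### Bounds for the quasi-Assouad dimensions -/

section QuasiDim

variable {X : Type*} [PseudoMetricSpace X] [MeasurableSpace X] {μ : Measure X} {ψ : ℝ}

theorem quasiAssouadDim_le (h : ∀ θ, 0 < θ → θ < 1 → UpperPhiBound (phiTheta θ) μ ψ) :
    quasiAssouadDim μ ≤ ψ := by
  refine le_of_tendsto (tendsto_quasiAssouadDim μ) ?_
  filter_upwards [Ioo_mem_nhdsLT (zero_lt_one (α := ℝ))] with θ hθ
  exact sInf_le ⟨ψ, h θ hθ.1 hθ.2, rfl⟩

theorem le_quasiAssouadDim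
    (h : ∀ θ, 0 < θ → θ < 1 → ∀ d, UpperPhiBound (phiTheta θ) μ d → ψ ≤ d) :
    ψ ≤ quasiAssouadDim μ := by
  refine ge_of_tendsto (tendsto_quasiAssouadDim μ) ?_
  filter_upwards [Ioo_mem_nhdsLT (zero_lt_one (α := ℝ))] with θ hθ
  refine le_sInf ?_
  rintro _ ⟨d, hd, rfl⟩
  exact EReal.coe_le_coe_iff.2 (h θ hθ.1 hθ.2 d hd)

theorem le_quasiLowerAssouadDim (h : ∀ θ, 0 < θ → θ < 1 → LowerPhiBound (phiTheta θ) μ ψ) :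
    ψ ≤ quasiLowerAssouadDim μ := by
  refine ge_of_tendsto (tendsto_quasiLowerAssouadDim μ) ?_
  filter_upwards [Ioo_mem_nhdsLT (zero_lt_one (α := ℝ))] with θ hθ
  exact le_sSup ⟨ψ, h θ hθ.1 hθ.2, rfl⟩

theorem quasiLowerAssouadDim_le
    (h : ∀ θ, 0 < θ → θ < 1 → ∀ d, LowerPhiBound (phiTheta θ) μ d → d ≤ ψ) :
    quasiLowerAssouadDim μ ≤ ψ := by
  refine le_of_tendsto (tendsto_quasiLowerAssouadDim μ) ?_
  filter_upwards [Ioo_mem_nhdsLT (zero_lt_one (α := ℝ))] with θ hθ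
  refine sSup_le ?_
  rintro _ ⟨d, hd, rfl⟩
  exact EReal.coe_le_coe_iff.2 (h θ hθ.1 hθ.2 d hd)

end QuasiDim

/-! ### The two extremal sequences of weights -/

namespace MoranBounds

variable {A B : ℝ} {a b : ℕ → ℝ} (h : MoranBounds A B a b) {p : ℕ → I}
  (hp : ∀ n, 0 < (p n : ℝ) ∧ (p n : ℝ) < 1)
include h hp

theorem log_sub_le_threshold (ψ : ℝ) (v : ℕ → Bool) (i : ℕ) :
    ψ * Real.log (moranRatio a b v i) - Real.log (moranWeight p v i)
      ≤ ψ * thresholdZ ψ (a i) (b i) (p i) - thresholdY ψ (a i) (b i) (p i) := by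
  rw [threshold_eq_max (h.ratios i).1 (h.ratios i).2.1 (hp i).1 (hp i).2]
  unfold moranRatio moranWeight
  split_ifs
  exacts [le_max_right _ _, le_max_left _ _]

theorem threshold'_le_log_sub (ψ : ℝ) (v : ℕ → Bool) (i : ℕ) :
    ψ * thresholdZ' ψ (a i) (b i) (p i) - thresholdY' ψ (a i) (b i) (p i)
      ≤ ψ * Real.log (moranRatio a b v i) - Real.log (moranWeight p v i) := by
  rw [threshold'_eq_min (h.ratios i).1 (h.ratios i).2.1 (hp i).1 (hp i).2]
  unfold moranRatio moranWeight
  split_ifs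
  exacts [min_le_right _ _, min_le_left _ _]

/-- The greedy branch takes a child attaining the maximum at every step. It is chosen for fixed
weights and ratios, so no measurable selection in `ω` is involved. -/
theorem exists_threshold_le_log_sub (ψ : ℝ) : ∃ v : ℕ → Bool, ∀ i,
    ψ * thresholdZ ψ (a i) (b i) (p i) - thresholdY ψ (a i) (b i) (p i)
      ≤ ψ * Real.log (moranRatio a b v i) - Real.log (moranWeight p v i) := by
  classical
  refine ⟨fun i => decide (ψ * Real.log (a i) - Real.log (p i)
    ≤ ψ * Real.log (b i) - Real.log (1 - p i)), fun i => ?_⟩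
  rw [threshold_eq_max (h.ratios i).1 (h.ratios i).2.1 (hp i).1 (hp i).2]
  by_cases hc : ψ * Real.log (a i) - Real.log (p i)
    ≤ ψ * Real.log (b i) - Real.log (1 - p i)
  · simp [moranRatio, moranWeight, hc]
  · simp [moranRatio, moranWeight, hc, (not_le.1 hc).le]

theorem exists_log_sub_le_threshold' (ψ : ℝ) : ∃ v : ℕ → Bool, ∀ i,
    ψ * Real.log (moranRatio a b v i) - Real.log (moranWeight p v i)
      ≤ ψ * thresholdZ' ψ (a i) (b i) (p i) - thresholdY' ψ (a i) (b i) (p i) := by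
  classical
  refine ⟨fun i => decide (ψ * Real.log (b i) - Real.log (1 - p i)
    ≤ ψ * Real.log (a i) - Real.log (p i)), fun i => ?_⟩
  rw [threshold'_eq_min (h.ratios i).1 (h.ratios i).2.1 (hp i).1 (hp i).2]
  by_cases hc : ψ * Real.log (b i) - Real.log (1 - p i)
    ≤ ψ * Real.log (a i) - Real.log (p i)
  · simp [moranRatio, moranWeight, hc]
  · simp [moranRatio, moranWeight, hc, (not_le.1 hc).le]

end MoranBounds

/-! ### The four almost sure bounds -/

theorem mainTheorem8 {Ω : Type*} [MeasurableSpace Ω] (P : Measure Ω) [IsProbabilityMeasure P]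
    (A B : ℝ) (hA : 0 < A) (hAB : A < B) (hB : B < 1)
    (a b : ℕ → Ω → ℝ) (p : ℕ → Ω → I)
    -- the scaling ratios: measurable, in the prescribed region, and i.i.d. as pairs
    (hab_meas : ∀ n, Measurable (fun ω => (a n ω, b n ω)))
    (hab_range : ∀ n ω, A ≤ min (a n ω) (b n ω) ∧ a n ω + b n ω ≤ B)
    (hab_indep : iIndepFun (fun n ω => (a n ω, b n ω)) P)
    (hab_ident : ∀ n, IdentDistrib (fun ω => (a n ω, b n ω)) (fun ω => (a 0 ω, b 0 ω)) P P)
    -- the probabilities: measurable, i.i.d., and independent of the scaling ratios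
    (hp_meas : ∀ n, Measurable (p n))
    (hp_indep : iIndepFun p P)
    (hp_ident : ∀ n, IdentDistrib (p n) (p 0) P P)
    (hp_ab : IndepFun (fun ω n => p n ω) (fun ω n => (a n ω, b n ω)) P)
    -- `𝔼[p^{-t}] < ∞` and `𝔼[(1-p)^{-t}] < ∞` for some `t > 0`, with `0^{-t} = ∞`
    (hp_moment : ∃ t : ℝ, 0 < t ∧
      (∫⁻ ω, ENNReal.ofReal (p 0 ω) ^ (-t) ∂P) < ⊤ ∧
      (∫⁻ ω, ENNReal.ofReal (1 - (p 0 ω : ℝ)) ^ (-t) ∂P) < ⊤)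
    (ψ : ℝ) (hψ : 0 ≤ ψ) :
    (thresholdG P (a 0) (b 0) (p 0) ψ < ψ →
      ∀ᵐ ω ∂P, quasiAssouadDim (moranMeasure (fun n => a n ω) (fun n => b n ω) (fun n => p n ω))
        ≤ (ψ : EReal)) ∧
    (ψ ≤ thresholdG P (a 0) (b 0) (p 0) ψ →
      ∀ᵐ ω ∂P, (ψ : EReal)
        ≤ quasiAssouadDim (moranMeasure (fun n => a n ω) (fun n => b n ω) (fun n => p n ω))) ∧
    (ψ < thresholdG' P (a 0) (b 0) (p 0) ψ →
      ∀ᵐ ω ∂P, (ψ : EReal)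
        ≤ quasiLowerAssouadDim
            (moranMeasure (fun n => a n ω) (fun n => b n ω) (fun n => p n ω))) ∧
    (thresholdG' P (a 0) (b 0) (p 0) ψ ≤ ψ →
      ∀ᵐ ω ∂P, quasiLowerAssouadDim
          (moranMeasure (fun n => a n ω) (fun n => b n ω) (fun n => p n ω))
        ≤ (ψ : EReal)) := by
  obtain ⟨t, ht, ht1, ht2⟩ := hp_moment
  have hbd : ∀ ω, MoranBounds A B (fun n => a n ω) (fun n => b n ω) := fun ω =>
    { pos := hA
      lt_one := hB
      le_left := fun n => (hab_range n ω).1.trans (min_le_left _ _)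
      le_right := fun n => (hab_range n ω).1.trans (min_le_right _ _)
      add_le := fun n => (hab_range n ω).2 }
  have hp0 : Measurable fun ω => (p 0 ω : ℝ) := measurable_subtype_coe.comp (hp_meas 0)
  have hp1 : Measurable fun ω => 1 - (p 0 ω : ℝ) := hp0.const_sub 1
  have hp_pos : ∀ᵐ ω ∂P, ∀ n, 0 < (p n ω : ℝ) ∧ (p n ω : ℝ) < 1 := by
    rw [ae_all_iff]
    intro n
    -- The moments concern `p 0` only; equality in law carries `0 < p < 1` to every level.
    refine (hp_ident n).symm.ae_snd (p := fun x : I => 0 < (x : ℝ) ∧ (x : ℝ) < 1)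
      ((measurableSet_lt measurable_const measurable_subtype_coe).inter
        (measurableSet_lt measurable_subtype_coe measurable_const)) ?_
    filter_upwards [ae_pos_of_lintegral_rpow_neg hp0 ht ht1,
      ae_pos_of_lintegral_rpow_neg hp1 ht ht2] with ω h1 h2
    exact ⟨h1, sub_pos.1 h2⟩
  -- A common integrable bound for `Y` and `Y'`, whichever child is selected.
  have hlog : Integrable (fun ω => |Real.log (p 0 ω)| + |Real.log (1 - (p 0 ω : ℝ))|) P :=
    (integrable_log_of_lintegral_rpow_neg hp0 (fun ω => (p 0 ω).2.1) (fun ω => (p 0 ω).2.2)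
      ht ht1).abs.add (integrable_log_of_lintegral_rpow_neg hp1
        (fun ω => sub_nonneg.2 (p 0 ω).2.2) (fun ω => sub_le_self 1 (p 0 ω).2.1) ht ht2).abs
  have hmeas : Measurable fun ω => ((a 0 ω, b 0 ω), p 0 ω) := (hab_meas 0).prodMk (hp_meas 0)
  have hlog_bd : ∀ x, A ≤ x → x ≤ B → Real.log A ≤ Real.log x ∧ Real.log x ≤ Real.log B :=
    fun x h1 h2 => ⟨Real.log_le_log hA h1, Real.log_le_log (hA.trans_le h1) h2⟩
  have ha_log : ∀ ω, Real.log A ≤ Real.log (a 0 ω) ∧ Real.log (a 0 ω) ≤ Real.log B := fun ω =>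
    hlog_bd _ ((hbd ω).le_left 0) ((hbd ω).ratio_le (fun _ => false) 0)
  have hb_log : ∀ ω, Real.log A ≤ Real.log (b 0 ω) ∧ Real.log (b 0 ω) ≤ Real.log B := fun ω =>
    hlog_bd _ ((hbd ω).le_right 0) ((hbd ω).ratio_le (fun _ => true) 0)
  have hlogB : Real.log B < 0 := Real.log_neg (hA.trans hAB) hB
  have hint : ∀ Z : Ω → ℝ, Measurable Z → (∀ ω, Real.log A ≤ Z ω ∧ Z ω ≤ Real.log B) →
      Integrable Z P ∧ ∫ ω, Z ω ∂P < 0 := by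
    intro Z hZ hZ_bd
    have hZ_int : Integrable Z P := by
      refine Integrable.of_bound hZ.aestronglyMeasurable (-Real.log A) (ae_of_all _ fun ω => ?_)
      have := hZ_bd ω
      rw [Real.norm_eq_abs, abs_le]
      constructor <;> linarith
    refine ⟨hZ_int, lt_of_le_of_lt ?_ hlogB⟩
    simpa using integral_mono hZ_int (integrable_const (Real.log B)) fun ω => (hZ_bd ω).2
  obtain ⟨hZ, hZ_neg⟩ := hint (fun ω => thresholdZ ψ (a 0 ω) (b 0 ω) (p 0 ω))
    ((measurable_thresholdZ ψ).comp hmeas) fun ω => by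
      unfold thresholdZ
      split_ifs
      exacts [ha_log ω, hb_log ω]
  obtain ⟨hZ', hZ'_neg⟩ := hint (fun ω => thresholdZ' ψ (a 0 ω) (b 0 ω) (p 0 ω))
    ((measurable_thresholdZ' ψ).comp hmeas) fun ω => by
      unfold thresholdZ'
      split_ifs
      exacts [ha_log ω, hb_log ω]
  have hY : Integrable (fun ω => thresholdY ψ (a 0 ω) (b 0 ω) (p 0 ω)) P := by
    refine hlog.mono' ((measurable_thresholdY ψ).comp hmeas).aestronglyMeasurable
      (ae_of_all _ fun ω => ?_)
    rw [Real.norm_eq_abs]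
    unfold thresholdY
    split_ifs
    exacts [le_add_of_nonneg_right (abs_nonneg _), le_add_of_nonneg_left (abs_nonneg _)]
  have hY' : Integrable (fun ω => thresholdY' ψ (a 0 ω) (b 0 ω) (p 0 ω)) P := by
    refine hlog.mono' ((measurable_thresholdY' ψ).comp hmeas).aestronglyMeasurable
      (ae_of_all _ fun ω => ?_)
    rw [Real.norm_eq_abs]
    unfold thresholdY'
    split_ifs
    exacts [le_add_of_nonneg_right (abs_nonneg _), le_add_of_nonneg_left (abs_nonneg _)]
  have hS := strong_law_prodMk hab_meas hp_meas hab_indep hp_indep hab_ident hp_ident hp_ab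
    (((measurable_thresholdZ ψ).const_mul ψ).sub (measurable_thresholdY ψ))
    ((hZ.const_mul ψ).sub hY)
  have hS' := strong_law_prodMk hab_meas hp_meas hab_indep hp_indep hab_ident hp_ident hp_ab
    (((measurable_thresholdZ' ψ).const_mul ψ).sub (measurable_thresholdY' ψ))
    ((hZ'.const_mul ψ).sub hY')
  simp only [Pi.sub_apply] at hS hS'
  rw [integral_sub (hZ.const_mul ψ) hY, integral_const_mul] at hS
  rw [integral_sub (hZ'.const_mul ψ) hY', integral_const_mul] at hS'
  simp only [thresholdG, thresholdG']
  -- The denominators are negative, so each hypothesis turns into a sign condition on the limit in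
  -- `hS` or `hS'`.
  rw [div_lt_iff_of_neg hZ_neg, le_div_iff_of_neg hZ_neg, lt_div_iff_of_neg hZ'_neg,
    div_le_iff_of_neg hZ'_neg]
  refine ⟨fun hG => ?_, fun hG => ?_, fun hG => ?_, fun hG => ?_⟩
  · filter_upwards [hp_pos, hS] with ω hω hSω
    exact quasiAssouadDim_le fun θ hθ hθ1 => (hbd ω).upperPhiBound hω hψ hθ hθ1
      ((hbd ω).log_sub_le_threshold hω ψ) hSω (sub_neg.2 hG)
  · filter_upwards [hp_pos, hS] with ω hω hSω
    obtain ⟨v, hv⟩ := (hbd ω).exists_threshold_le_log_sub hω ψ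
    exact le_quasiAssouadDim fun θ hθ hθ1 d hd =>
      (hbd ω).le_of_upperPhiBound hω hθ hθ1 hv hSω (sub_nonneg.2 hG) hd
  · filter_upwards [hp_pos, hS'] with ω hω hSω
    exact le_quasiLowerAssouadDim fun θ hθ hθ1 => (hbd ω).lowerPhiBound hω hψ hθ hθ1
      ((hbd ω).threshold'_le_log_sub hω ψ) hSω (sub_pos.2 hG)
  · filter_upwards [hp_pos, hS'] with ω hω hSω
    obtain ⟨v, hv⟩ := (hbd ω).exists_log_sub_le_threshold' hω ψ
    exact quasiLowerAssouadDim_le fun θ hθ hθ1 d hd =>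
      (hbd ω).le_of_lowerPhiBound hω hθ hθ1 hv hSω (sub_nonpos.2 hG) hd
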